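/- Let $n,m\ge 0$, let $x_1,\dots,x_n\in\mathbb R$ be distinct, and let $\xi_1,\dots,\xi_m\in\mathbb C$ be distinct, different from all the $x_j$, such that the set $\{\xi_1,\dots,\xi_m\}$ is closed under complex conjugation and the stationary relations $$-\sum_{j=1}^n\frac1{\xi_k-x_j}+\sum_{l\ne k}\frac2{\xi_k-\xi_l}=0,\qquad k=1,\dots,m,$$ hold. For distinct real $y_1,\dots,y_n$ let $\mathcal{CR}_{m,n}(y)$ be the class of rational functions $R$ such that $\overline{R(\bar z)}=R(z)$; the finite critical points of $R$ (zeros of $R'$ that are not poles) are exactly $y_1,\dots,y_n$, and all are simple; $R$ has exactly $m$ finite poles, all simple; and $R$ has a pole of order $n-2m+1$ at infinity, meaning that in lowest terms the degree of the numerator minus the degree of the denominator is $n-2m+1$ (so that $R$ has a zero of order $2m-n-1$ at infinity if this number is negative). Let $\Gamma(R)=\{z\in\mathbb C: R(z)\in\mathbb R\cup\{\infty\}\}$ be its real locus. Then there is an $R\in\mathcal{CR}_{m,n}(x)$ whose finite poles are exactly $\xi_1,\dots,\xi_m$ (and whose finite critical points are $x_1,\dots,x_n$) such that the following holds. Let $\nu_1,\dots,\nu_n:[0,\infty)\to[0,\infty)$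 and $T>0$, with every $\nu_j$ integrable on $[0,t]$ for all $t<T$, and let $x_j(t)\in\mathbb R$ and $\xi_k(t)\in\mathbb C$ be continuous on $[0,T)$, with $x_j(0)=x_j$ and $\xi_k(0)=\xi_k$, and solve there (in integrated form) $$\dot x_j=\nu_j(t)\Big(\sum_{k\ne j}\frac2{x_j-x_k}-\sum_{l=1}^m\frac4{x_j-\xi_l}\Big)+\sum_{k\neq j}\frac{2\nu_k(t)}{x_j-x_k},\qquad \dot\xi_k=\sum_{j=1}^n\frac{2\nu_j(t)}{\xi_k-x_j},$$ where for every $t\in[0,T)$ the $n+m$ points $x_1(t),\dots,x_n(t),\xi_1(t),\dots,\xi_m(t)$ are distinct. Let $g_t(z)$ be the solution of $\partial_tg_t(z)=\sum_{j}\frac{2\nu_j(t)}{g_t(z)-x_j(t)}$, $g_0(z)=z$ (in integrated form), let $\tau_z$ be the first time at which it meets one of the $x_j(t)$, and let $K_t=\{z\in\overline{\mathbb H}:\tau_z\le t\}$. Then for every $t\in[0,T)$: (i) $K_t\subseteq\Gamma(R)$; (ii) $g_t$ maps $\mathbb H\setminus K_t$ bijectively onto $\mathbb H$, and $R\circ g_t^{-1}\in\mathcal{CR}_{m,n}(x(t))$;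 that is, $R\circ g_t^{-1}$ coincides on $\mathbb H$, as a map to the Riemann sphere, with an element of $\mathcal{CR}_{m,n}(x(t))$. -/

import Mathlib

namespace ChordalSLE

noncomputable section

/-! ### Rational functions, their poles, critical points and real locus -/

/-- The rational function `R` as a function on `ℂ`, given by its fraction in lowest terms.
It is the honest value of `R` away from the poles, that is, where `R.denom` does not vanish. -/
def evalFun (R : RatFunc ℂ) (z : ℂ) : ℂ :=
  R.num.eval z / R.denom.eval z

open Classical in
/-- The rational function `R` as a map from `ℂ` to the Riemann sphere `ℂ ∪ {∞}`. -/
def evalSphere (R : RatFunc ℂ) (z : ℂ) : OnePoint ℂ :=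
  if R.denom.eval z = 0 then OnePoint.infty else ((evalFun R z : ℂ) : OnePoint ℂ)

/-- The (finite part of the) real locus `Γ(R)`: the points `z ∈ ℂ` with `R z ∈ ℝ ∪ {∞}`. -/
def realLocus (R : RatFunc ℂ) : Set ℂ :=
  {z | evalSphere R z = OnePoint.infty ∨ ∃ r : ℝ, evalSphere R z = ((r : ℂ) : OnePoint ℂ)}

/-- `z` is a finite critical point of `R`: not a pole, and `R' z = 0`. -/
def IsCriticalPoint (R : RatFunc ℂ) (z : ℂ) : Prop :=
  R.denom.eval z ≠ 0 ∧ deriv (evalFun R) z = 0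

/-- `z` is a simple critical point of `R`: a critical point at which `R'' z ≠ 0`. -/
def IsSimpleCriticalPoint (R : RatFunc ℂ) (z : ℂ) : Prop :=
  IsCriticalPoint R z ∧ deriv (deriv (evalFun R)) z ≠ 0

/-- The points `ξ 0, …, ξ (m - 1)` are distinct, they are exactly the finite poles of `R`, and
all of them are simple: the (monic) denominator in lowest terms is `∏ (X - ξ k)`. -/
def HasSimplePolesAt {m : ℕ} (R : RatFunc ℂ) (ξ : Fin m → ℂ) : Prop :=
  Function.Injective ξ ∧ R.denom = ∏ k, (Polynomial.X - Polynomial.C (ξ k))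

/-- The class `CR_{m,n}(x)`: rational functions, symmetric under conjugation, whose finite critical
points are exactly the `n` distinct real points `x j`, all simple, which have exactly `m` finite
poles, all simple, and which have a pole of order `n - 2m + 1` at infinity. The order of the pole at
infinity is the degree of the numerator minus that of the denominator; if it is negative, `R`
has a zero of order `2m - n - 1` at infinity. -/
structure IsCR (m : ℕ) {n : ℕ} (x : Fin n → ℝ) (R : RatFunc ℂ) : Prop where
  distinct : Function.Injective x
  conj_symm : ∀ z : ℂ, starRingEnd ℂ (evalFun R (starRingEnd ℂ z)) = evalFun R z
  critical : ∀ z : ℂ, IsCriticalPoint R z ↔ ∃ j, z = (x j : ℂ)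
  critical_simple : ∀ j, IsSimpleCriticalPoint R (x j : ℂ)
  poles : ∃ ξ : Fin m → ℂ, HasSimplePolesAt R ξ
  order_infinity : (R.num.natDegree : ℤ) - (R.denom.natDegree : ℤ) = (n : ℤ) - 2 * (m : ℤ) + 1

/-! ### Stationary relations -/

/-- The stationary relations (with marked point `u = ∞`) between the growth points `x` and the
screening charges `ξ`. -/
def StationaryRelations {n m : ℕ} (x : Fin n → ℝ) (ξ : Fin m → ℂ) : Prop :=
  ∀ k, -(∑ j, 1 / (ξ k - (x j : ℂ))) + ∑ l ∈ Finset.univ.erase k, 2 / (ξ k - ξ l) = 0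

/-- No two of the growth points and screening charges coincide. -/
structure NoCollision {n m : ℕ} (x : Fin n → ℝ) (ξ : Fin m → ℂ) : Prop where
  growth : Function.Injective x
  charges : Function.Injective ξ
  mixed : ∀ j k, ξ k ≠ (x j : ℂ)

/-! ### The multiple chordal Loewner flow -/

/-- The partial derivative `∂ log Z / ∂ x_j` of the logarithm of
`Z(x, ξ) = ∏_{i<j} (x_i - x_j)^2 ∏_{k<l} (ξ_k - ξ_l)^8 ∏_{i,k} (x_i - ξ_k)^{-4}`,
with `x` and `ξ` treated as independent variables. -/
def dlogZ {n m : ℕ} (x : Fin n → ℝ) (ξ : Fin m → ℂ) (j : Fin n) : ℂ :=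
  ∑ k ∈ Finset.univ.erase j, 2 / ((x j : ℂ) - (x k : ℂ)) - ∑ l, 4 / ((x j : ℂ) - ξ l)

/-- The right-hand side of the Loewner equation at the point `w`, for the weights `ν` and the
growth points `x` at a given time. -/
def loewnerField {n : ℕ} (ν x : Fin n → ℝ) (w : ℂ) : ℂ :=
  ∑ j, 2 * (ν j : ℂ) / (w - (x j : ℂ))

/-- `x` (growth points) and `ξ` (screening charges) evolve on `[0, T)`, without collision, under the
multiple chordal SLE(0) flow with capacity parametrization `ν` and initial values `x₀`, `ξ₀`:
`x_j' = ν_j ∂ log Z / ∂ x_j + ∑_{k ≠ j} 2 ν_k / (x_j - x_k)` and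
`ξ_k' = ∑_j 2 ν_j / (ξ_k - x_j)`, in integrated form since `ν` is merely measurable. -/
structure IsMultipleFlow {n m : ℕ} (ν : ℝ → Fin n → ℝ) (x₀ : Fin n → ℝ) (ξ₀ : Fin m → ℂ) (T : ℝ)
    (x : ℝ → Fin n → ℝ) (ξ : ℝ → Fin m → ℂ) : Prop where
  nonneg : ∀ t, 0 ≤ t → ∀ j, 0 ≤ ν t j
  integrable : ∀ t ∈ Set.Ico 0 T, ∀ j,
    IntervalIntegrable (fun s => ν s j) MeasureTheory.volume 0 t
  continuousOn_growth : ContinuousOn x (Set.Ico 0 T)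
  continuousOn_charges : ContinuousOn ξ (Set.Ico 0 T)
  noCollision : ∀ t ∈ Set.Ico 0 T, NoCollision (x t) (ξ t)
  growth_eq : ∀ t ∈ Set.Ico 0 T, ∀ j,
    (x t j : ℂ) = (x₀ j : ℂ) + ∫ s in (0 : ℝ)..t,
      ((ν s j : ℂ) * dlogZ (x s) (ξ s) j
        + ∑ k ∈ Finset.univ.erase j, 2 * (ν s k : ℂ) / ((x s j : ℂ) - (x s k : ℂ)))
  charges_eq : ∀ t ∈ Set.Ico 0 T, ∀ k,
    ξ t k = ξ₀ k + ∫ s in (0 : ℝ)..t, loewnerField (ν s) (x s) (ξ s k)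

/-- `γ` solves on `[0, t]` the Loewner equation `∂_s γ = ∑_j 2 ν_j / (γ - x_j)`, `γ 0 = z`,
(in integrated form) and does not meet any growth point there. -/
structure IsLoewnerOrbit {n : ℕ} (ν x : ℝ → Fin n → ℝ) (z : ℂ) (t : ℝ) (γ : ℝ → ℂ) : Prop where
  continuousOn : ContinuousOn γ (Set.Icc 0 t)
  ne_growth : ∀ s ∈ Set.Icc 0 t, ∀ j, γ s ≠ (x s j : ℂ)
  eq_integral : ∀ s ∈ Set.Icc 0 t,
    γ s = z + ∫ r in (0 : ℝ)..s, loewnerField (ν r) (x r) (γ r)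

open Classical in
/-- The flow map `g_t(z)`: the value at time `t` of the solution started at `z` (which is unique).
The value is irrelevant if there is no solution up to time `t`. -/
def flowMap {n : ℕ} (ν x : ℝ → Fin n → ℝ) (t : ℝ) (z : ℂ) : ℂ :=
  if h : ∃ γ, IsLoewnerOrbit ν x z t γ then h.choose t else 0

/-- The swallowing time `τ_z`: the lifetime of the solution started at `z`, that is, the first time
at which it meets a growth point (`∞` if it never does). -/
def swallowingTime {n : ℕ} (ν x : ℝ → Fin n → ℝ) (z : ℂ) : ENNReal :=
  ⨆ (t : NNReal) (_ : ∃ γ, IsLoewnerOrbit ν x z (t : ℝ) γ), (t : ENNReal)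

/-- The hull `K_t`: the points of the closed upper half-plane with `τ_z ≤ t`. -/
def hull {n : ℕ} (ν x : ℝ → Fin n → ℝ) (t : ℝ) : Set ℂ :=
  {z | 0 ≤ z.im ∧ swallowingTime ν x z ≤ ENNReal.ofReal t}

/-- The open upper half-plane. -/
def upperHalf : Set ℂ := {z | 0 < z.im}

/-- The inverse map `g_t⁻¹` of `g_t`, as a map on the image of `ℍ \ K_t`. -/
def flowMapInv {n : ℕ} (ν x : ℝ → Fin n → ℝ) (t : ℝ) : ℂ → ℂ :=
  Function.invFunOn (flowMap ν x t) (upperHalf \ hull ν x t)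

end

end ChordalSLE

open Set Filter Topology MeasureTheory

namespace ChordalSLE

section

/-! ### Linear equations with integrable coefficients -/

/-! Write `P = ∏ (z - x j)` and `Q = ∏ (z - ξ k)`. The stationary relations say exactly that `P / Q
^ 2` has zero residue at every `ξ k`, so it has a rational primitive `R = A / Q`, that is `A' Q - A
Q' = P` (`exists_derivative_quotient`). Averaging with the conjugate makes `R` real, and subtracting
a constant makes it vanish or blow up at infinity (`exists_isNumerator`).

The one-form `P / Q ^ 2 dz` is transported by the flow. Along an orbit its density is multiplied by
`exp ∫ ∑ 2 ν_j / (γ - x_j)^2` (`density_eq`), which is the derivative of the inverse flow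
(`hasDerivAt_start`). Each stationary relation solves a linear homogeneous equation, so it persists
(`stationary`), and a primitive `R_t` exists at time `t`. Hence `R ∘ g_t⁻¹` and `R_t` differ by a
constant. That constant is computed on a half-plane far to the right, where the inverse flow is
close to the identity: it is real, so it can be absorbed into `R_t` if there is a pole at infinity,
and it is zero otherwise. The identity theorem carries the equality to the upper half-plane
(`exists_numerator`).

A swallowed point of the upper half-plane has an orbit passing arbitrarily close to the growth
points. There `R_s` is nearly real, uniformly in `s`, while `R_s (γ s) = R z`; so `R z` is real or
infinite (`hull_subset`). Surjectivity of `g_t` comes from the backward flow, along which imaginary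
parts do not decrease.

Since `ν` is only integrable, all evolution equations are used in integrated form. Each is brought
to `d = d₀ + ∫ a d` and solved by `eq_mul_exp_of_linear`. -/

theorem absolutelyContinuous_comp {f : ℝ → ℂ} {g : ℂ → ℂ} {a b : ℝ} {K : NNReal}
    (hf : AbsolutelyContinuousOnInterval f a b) (hg : LipschitzOnWith K g (f '' uIcc a b)) :
    AbsolutelyContinuousOnInterval (fun s => g (f s)) a b := by
  rw [absolutelyContinuousOnInterval_iff] at hf ⊢
  intro ε hε
  obtain ⟨δ, hδ, H⟩ := hf (ε / (K + 1)) (by positivity)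
  refine ⟨δ, hδ, fun E hE hlen => ?_⟩
  have h1 := H E hE hlen
  calc ∑ i ∈ Finset.range E.1, dist (g (f (E.2 i).1)) (g (f (E.2 i).2))
      ≤ ∑ i ∈ Finset.range E.1, K * dist (f (E.2 i).1) (f (E.2 i).2) := by
        refine Finset.sum_le_sum fun i hi => ?_
        have := hE.1 i hi
        exact hg.dist_le_mul _ (mem_image_of_mem _ this.1) _ (mem_image_of_mem _ this.2)
    _ = K * ∑ i ∈ Finset.range E.1, dist (f (E.2 i).1) (f (E.2 i).2) := by
        rw [Finset.mul_sum]
    _ ≤ (K + 1) * ∑ i ∈ Finset.range E.1, dist (f (E.2 i).1) (f (E.2 i).2) := by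
        gcongr
        linarith
    _ < (K + 1) * (ε / (K + 1)) := by gcongr
    _ = ε := by field_simp

theorem intervalIntegrable_ofReal {f : ℝ → ℝ} {a b : ℝ} (hf : IntervalIntegrable f volume a b) :
    IntervalIntegrable (fun r => (f r : ℂ)) volume a b :=
  ⟨hf.1.ofReal, hf.2.ofReal⟩

theorem intervalIntegrable_fun_sum {ι E : Type*} [NormedAddCommGroup E] {s : Finset ι}
    {f : ι → ℝ → E} {a b : ℝ} (h : ∀ i ∈ s, IntervalIntegrable (f i) volume a b) :
    IntervalIntegrable (fun r => ∑ i ∈ s, f i r) volume a b := by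
  have e : (fun r => ∑ i ∈ s, f i r) = ∑ i ∈ s, f i := by ext r; simp
  exact e ▸ IntervalIntegrable.sum s h

/-- Real and imaginary parts are treated separately, each with half of `ε`. -/
theorem absolutelyContinuous_integral {f : ℝ → ℂ} {t : ℝ} (hf : IntervalIntegrable f volume 0 t) :
    AbsolutelyContinuousOnInterval (fun s => ∫ r in (0 : ℝ)..s, f r) 0 t := by
  have hre : IntervalIntegrable (fun r => (f r).re) volume 0 t :=
    ⟨hf.1.re, hf.2.re⟩
  have him : IntervalIntegrable (fun r => (f r).im) volume 0 t :=
    ⟨hf.1.im, hf.2.im⟩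
  have h1 := hre.absolutelyContinuousOnInterval_intervalIntegral left_mem_uIcc
  have h2 := him.absolutelyContinuousOnInterval_intervalIntegral left_mem_uIcc
  rw [absolutelyContinuousOnInterval_iff] at h1 h2 ⊢
  intro ε hε
  obtain ⟨δ₁, hδ₁, H₁⟩ := h1 (ε / 2) (by positivity)
  obtain ⟨δ₂, hδ₂, H₂⟩ := h2 (ε / 2) (by positivity)
  refine ⟨min δ₁ δ₂, lt_min hδ₁ hδ₂, fun E hE hlen => ?_⟩
  have e1 := H₁ E hE (hlen.trans_le (min_le_left _ _))
  have e2 := H₂ E hE (hlen.trans_le (min_le_right _ _))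
  have key : ∀ s ∈ uIcc 0 t, (∫ r in (0 : ℝ)..s, f r)
      = ((∫ r in (0 : ℝ)..s, (f r).re : ℝ) : ℂ) + ((∫ r in (0 : ℝ)..s, (f r).im : ℝ) : ℂ) * Complex.I := by
    intro s hs
    have hfs : IntervalIntegrable f volume 0 s := hf.mono_set (uIcc_subset_uIcc_left hs)
    rw [← intervalIntegral.integral_ofReal, ← intervalIntegral.integral_ofReal,
      ← intervalIntegral.integral_mul_const, ← intervalIntegral.integral_add]
    · simp [Complex.re_add_im]
    · exact ⟨hfs.1.re.ofReal, hfs.2.re.ofReal⟩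
    · exact IntervalIntegrable.mul_const ⟨hfs.1.im.ofReal, hfs.2.im.ofReal⟩ _
  calc _ ≤ ∑ i ∈ Finset.range E.1,
        (dist (∫ r in (0 : ℝ)..(E.2 i).1, (f r).re) (∫ r in (0 : ℝ)..(E.2 i).2, (f r).re)
        + dist (∫ r in (0 : ℝ)..(E.2 i).1, (f r).im) (∫ r in (0 : ℝ)..(E.2 i).2, (f r).im)) := by
        refine Finset.sum_le_sum fun i hi => ?_
        have := hE.1 i hi
        rw [key _ this.1, key _ this.2, dist_eq_norm, Real.dist_eq, Real.dist_eq]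
        refine (Complex.norm_le_abs_re_add_abs_im _).trans_eq ?_
        simp
    _ < ε := by rw [Finset.sum_add_distrib]; linarith

theorem exists_lipschitzOnWith_exp {h : ℝ → ℂ} {a b : ℝ} (hc : ContinuousOn h (uIcc a b)) :
    ∃ K : NNReal, LipschitzOnWith K Complex.exp (h '' uIcc a b) := by
  obtain ⟨C, hC⟩ := isCompact_uIcc.exists_bound_of_continuousOn hc
  obtain ⟨K, hK⟩ := (Complex.contDiff_exp (𝕜 := ℝ) (n := 1)).contDiffOn.exists_lipschitzOnWith
    one_ne_zero (convex_closedBall (0 : ℂ) C) (isCompact_closedBall (0 : ℂ) C)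
  refine ⟨K, hK.mono ?_⟩
  rintro _ ⟨s, hs, rfl⟩
  simpa using hC s hs

theorem absolutelyContinuous_exp_integral {f : ℝ → ℂ} {t : ℝ}
    (hf : IntervalIntegrable f volume 0 t) :
    AbsolutelyContinuousOnInterval (fun s => Complex.exp (∫ r in (0 : ℝ)..s, f r)) 0 t := by
  obtain ⟨K, hK⟩ := exists_lipschitzOnWith_exp (absolutelyContinuous_integral hf).continuousOn
  exact absolutelyContinuous_comp (absolutelyContinuous_integral hf) hK

theorem continuousOn_integral {f : ℝ → ℂ} {t : ℝ} (ht : 0 ≤ t)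
    (hf : IntervalIntegrable f volume 0 t) :
    ContinuousOn (fun s => ∫ r in (0 : ℝ)..s, f r) (Icc 0 t) := by
  have := (absolutelyContinuous_integral hf).continuousOn
  rwa [uIcc_of_le ht] at this

theorem intervalIntegrable_mul_continuousOn {a c : ℝ → ℂ} {t : ℝ} (ht : 0 ≤ t)
    (ha : IntervalIntegrable a volume 0 t) (hc : ContinuousOn c (Icc 0 t)) :
    IntervalIntegrable (fun s => a s * c s) volume 0 t :=
  ha.mul_continuousOn (by rwa [uIcc_of_le ht])

/-- The exponential of an integral solves the corresponding linear equation. -/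
theorem exp_integral_eq {a : ℝ → ℂ} {t : ℝ} (ht : 0 ≤ t) (ha : IntervalIntegrable a volume 0 t) :
    Complex.exp (∫ r in (0 : ℝ)..t, a r)
      = 1 + ∫ s in (0 : ℝ)..t, a s * Complex.exp (∫ r in (0 : ℝ)..s, a r) := by
  have hE := absolutelyContinuous_exp_integral ha
  have hint := intervalIntegrable_mul_continuousOn ht ha
    (Complex.continuous_exp.comp_continuousOn (continuousOn_integral ht ha))
  -- The difference of the two sides is absolutely continuous with derivative zero almost
  -- everywhere, hence constant.
  have hG := hE.sub (absolutelyContinuous_integral hint)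
  obtain ⟨C, hC⟩ := hG.const_of_ae_hasDerivAt_zero (by
    filter_upwards [ha.ae_hasDerivAt_integral, hint.ae_hasDerivAt_integral] with s h1 h2 hs
    have e1 := (h1 hs 0 left_mem_uIcc).cexp
    have e2 := h2 hs 0 left_mem_uIcc
    convert e1.sub e2 using 1
    simp [mul_comm])
  have h0 := hC 0 left_mem_uIcc
  have h1 := hC t right_mem_uIcc
  simp only [Pi.sub_apply, intervalIntegral.integral_same, Complex.exp_zero, sub_zero,
    Function.comp_apply] at h0 h1
  rw [← h0] at h1
  linear_combination h1

/-- Solutions of a linear equation with integrable coefficient. -/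
theorem eq_mul_exp_of_linear {a d : ℝ → ℂ} {d₀ : ℂ} {t : ℝ} (ht : 0 ≤ t)
    (ha : IntervalIntegrable a volume 0 t) (hd : ContinuousOn d (Icc 0 t))
    (h : ∀ s ∈ Icc 0 t, d s = d₀ + ∫ r in (0 : ℝ)..s, a r * d r) :
    d t = d₀ * Complex.exp (∫ r in (0 : ℝ)..t, a r) := by
  have hint := intervalIntegrable_mul_continuousOn ht ha hd
  have hna : IntervalIntegrable (fun r => -a r) volume 0 t := ha.neg
  have hE := absolutelyContinuous_exp_integral hna
  have hconst : AbsolutelyContinuousOnInterval (fun _ : ℝ => d₀) 0 t :=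
    ((contDiff_const (𝕜 := ℝ) (n := 1)).contDiffOn).absolutelyContinuousOnInterval
  -- The product `(d₀ + ∫ a d) * exp (-∫ a)` has derivative zero almost everywhere. The right-hand
  -- side of `h` stands in for `d`, whose absolute continuity is not assumed.
  have hG := (hconst.add (absolutelyContinuous_integral hint)).smul hE
  obtain ⟨C, hC⟩ := hG.const_of_ae_hasDerivAt_zero (by
    filter_upwards [hna.ae_hasDerivAt_integral, hint.ae_hasDerivAt_integral] with s h1 h2 hs
    have e1 := (h1 hs 0 left_mem_uIcc).cexp
    have e2 := (h2 hs 0 left_mem_uIcc).const_add d₀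
    have hs' : s ∈ Icc 0 t := by rwa [uIcc_of_le ht] at hs
    refine (e2.mul e1).congr_deriv ?_
    rw [← h s hs']
    ring)
  have h0 := hC 0 left_mem_uIcc
  have h1 := hC t right_mem_uIcc
  simp only [Pi.add_apply, Pi.smul_apply', intervalIntegral.integral_same, add_zero,
    Complex.exp_zero, smul_eq_mul, mul_one] at h0 h1
  rw [← h t (right_mem_Icc.mpr ht), ← h0, intervalIntegral.integral_neg] at h1
  rw [← h1, mul_assoc, ← Complex.exp_add]
  simp

/-! ### Existence of solutions with integrable Lipschitz constants -/

/-- Carathéodory's existence theorem with an integrable Lipschitz constant. -/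
theorem exists_integral_solution {F : ℝ → ℂ → ℂ} {k : ℝ → ℝ} {t : ℝ} (ht : 0 ≤ t)
    (hk : IntervalIntegrable k volume 0 t)
    (hF : ∀ γ : ℝ → ℂ, Continuous γ → IntervalIntegrable (fun s => F s (γ s)) volume 0 t)
    (hlip : ∀ s ∈ Icc 0 t, ∀ u v, ‖F s u - F s v‖ ≤ k s * ‖u - v‖) (z : ℂ) :
    ∃ γ : ℝ → ℂ, Continuous γ ∧ ∀ s ∈ Icc 0 t, γ s = z + ∫ r in (0 : ℝ)..s, F r (γ r) := by
  have hsub : ∀ s ∈ Icc 0 t, uIcc 0 s ⊆ uIcc 0 t := fun s hs =>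
    uIcc_subset_uIcc_left (by rwa [uIcc_of_le ht])
  let ext : C(Icc 0 t, ℂ) → ℝ → ℂ := fun γ => IccExtend ht γ
  have hext : ∀ γ, Continuous (ext γ) := fun γ => γ.continuous.Icc_extend'
  have hextval : ∀ γ s (hs : s ∈ Icc 0 t), ext γ s = γ ⟨s, hs⟩ := fun γ s hs =>
    IccExtend_of_mem ht _ hs
  let Φ : C(Icc 0 t, ℂ) → C(Icc 0 t, ℂ) := fun γ =>
    ⟨fun s => z + ∫ r in (0 : ℝ)..s, F r (ext γ r), continuous_const.add
      (continuousOn_iff_continuous_domRestrict.mp (continuousOn_integral ht (hF _ (hext γ))))⟩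
  -- A weight adapted to the equation: the factor `2` gives `∫ k E = (E - 1) / 2`, so each Picard
  -- step halves the distance measured against `E`.
  let E : ℝ → ℝ := fun s => Real.exp (∫ r in (0 : ℝ)..s, 2 * k r)
  have h2k : IntervalIntegrable (fun r => 2 * k r) volume 0 t := hk.const_mul 2
  have hEint : ∀ s ∈ Icc 0 t, E s = 1 + 2 * ∫ r in (0 : ℝ)..s, k r * E r := by
    intro s hs
    have hc : IntervalIntegrable (fun r => ((2 * k r : ℝ) : ℂ)) volume 0 s :=
      (intervalIntegrable_ofReal h2k).mono_set (hsub s hs)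
    have := exp_integral_eq hs.1 hc
    simp only [intervalIntegral.integral_ofReal, ← Complex.ofReal_exp] at this
    norm_cast at this
    rw [intervalIntegral.integral_ofReal] at this
    norm_cast at this
    simp only [E]
    rw [this, ← intervalIntegral.integral_const_mul]
    simp only [mul_assoc]
  have hEc : ContinuousOn E (Icc 0 t) := by
    have := intervalIntegral.continuousOn_primitive_interval' h2k left_mem_uIcc
    rw [uIcc_of_le ht] at this
    exact Real.continuous_exp.comp_continuousOn this
  have hkE : IntervalIntegrable (fun r => k r * E r) volume 0 t :=
    hk.mul_continuousOn (by rwa [uIcc_of_le ht])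
  have hbound : ∀ γ₁ γ₂ : C(Icc 0 t, ℂ), ∀ n : ℕ, ∀ s : Icc 0 t,
      dist ((Φ^[n] γ₁) s) ((Φ^[n] γ₂) s) ≤ E s / 2 ^ n * dist γ₁ γ₂ := by
    intro γ₁ γ₂ n
    have hk0 : ∀ s ∈ Icc 0 t, 0 ≤ k s := fun s hs => by
      simpa using (norm_nonneg _).trans (hlip s hs 1 0)
    induction n with
    | zero =>
      intro s
      have h1 : 1 ≤ E s := by
        refine Real.one_le_exp (intervalIntegral.integral_nonneg s.2.1 fun r hr => ?_)
        exact mul_nonneg zero_le_two (hk0 r ⟨hr.1, hr.2.trans s.2.2⟩)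
      simp only [Function.iterate_zero, id, pow_zero, div_one]
      exact (ContinuousMap.dist_apply_le_dist s).trans (le_mul_of_one_le_left dist_nonneg h1)
    | succ n ih =>
      intro s
      rw [Function.iterate_succ_apply', Function.iterate_succ_apply', dist_eq_norm]
      have e1 := (hF _ (hext (Φ^[n] γ₁))).mono_set (hsub s s.2)
      have e2 := (hF _ (hext (Φ^[n] γ₂))).mono_set (hsub s s.2)
      have e3 := hkE.mono_set (hsub s s.2)
      have : (Φ (Φ^[n] γ₁)) s - (Φ (Φ^[n] γ₂)) s
          = ∫ r in (0 : ℝ)..s, (F r (ext (Φ^[n] γ₁) r) - F r (ext (Φ^[n] γ₂) r)) := by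
        rw [intervalIntegral.integral_sub e1 e2]
        simp [Φ]
      rw [this]
      calc _ ≤ ∫ r in (0 : ℝ)..s, (k r * E r) * (dist γ₁ γ₂ / 2 ^ n) := by
            refine intervalIntegral.norm_integral_le_of_norm_le s.2.1
              (Eventually.of_forall fun r hr => ?_) (e3.mul_const _)
            have hr' : r ∈ Icc 0 t := ⟨hr.1.le, hr.2.trans s.2.2⟩
            refine (hlip r hr' _ _).trans ?_
            rw [hextval _ r hr', hextval _ r hr', ← dist_eq_norm, mul_assoc]
            refine mul_le_mul_of_nonneg_left ((ih ⟨r, hr'⟩).trans_eq ?_) (hk0 r hr')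
            ring
        _ = (E s - 1) / 2 * (dist γ₁ γ₂ / 2 ^ n) := by
            rw [intervalIntegral.integral_mul_const, hEint s s.2]
            ring
        _ ≤ E s / 2 * (dist γ₁ γ₂ / 2 ^ n) := by
            gcongr
            linarith
        _ = _ := by rw [pow_succ]; ring
  have hEmono : ∀ s : Icc 0 t, E s ≤ E t := by
    intro s
    refine Real.exp_le_exp.mpr (intervalIntegral.integral_mono_interval le_rfl s.2.1 s.2.2 ?_ h2k)
    filter_upwards [ae_restrict_mem measurableSet_Ioc] with r hr
    have := (norm_nonneg _).trans (hlip r ⟨hr.1.le, hr.2⟩ 1 0)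
    simp at this
    simpa using this
  obtain ⟨n, hn⟩ := pow_unbounded_of_one_lt (E t) one_lt_two
  -- Once `E t < 2 ^ n`, the `n`-th iterate contracts in the plain supremum metric; its fixed point
  -- is also fixed by `Φ`.
  have hcontr : ContractingWith (Real.toNNReal (E t / 2 ^ n)) Φ^[n] := by
    refine ⟨by rwa [Real.toNNReal_lt_one, div_lt_one (by positivity)],
      LipschitzWith.of_dist_le_mul fun γ₁ γ₂ => ?_⟩
    rw [Real.coe_toNNReal _ (by positivity), ContinuousMap.dist_le (by positivity)]
    intro s
    refine (hbound γ₁ γ₂ n s).trans ?_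
    gcongr
    exact hEmono s
  have hfix := hcontr.isFixedPt_fixedPoint_iterate
  set γ := ContractingWith.fixedPoint Φ^[n] hcontr
  refine ⟨ext γ, hext γ, fun s hs => ?_⟩
  rw [hextval γ s hs]
  conv_lhs => rw [← hfix]
  rfl

end

section

/-! ### Truncated inversion -/

/-- A globally Lipschitz function that agrees with `u⁻¹` for `δ ≤ ‖u‖`. -/
noncomputable def truncInv (δ : ℝ) (u : ℂ) : ℂ :=
  starRingEnd ℂ u / ((max ‖u‖ δ : ℝ) : ℂ) ^ 2

theorem truncInv_eq_inv {δ : ℝ} {u : ℂ} (h : δ ≤ ‖u‖) : truncInv δ u = u⁻¹ := by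
  rw [truncInv, max_eq_left h, Complex.inv_def, Complex.normSq_eq_norm_sq, div_eq_mul_inv]
  push_cast
  rfl

theorem norm_truncInv_le {δ : ℝ} (hδ : 0 < δ) (u : ℂ) : ‖truncInv δ u‖ ≤ 1 / δ := by
  have hp : 0 < max ‖u‖ δ := lt_max_of_lt_right hδ
  rw [truncInv, norm_div, norm_pow, RCLike.norm_conj, Complex.norm_real, Real.norm_of_nonneg hp.le,
    div_le_div_iff₀ (by positivity) hδ, one_mul, sq]
  exact mul_le_mul (le_max_left _ _) (le_max_right _ _) hδ.le hp.le

theorem norm_truncInv_sub_le {δ : ℝ} (hδ : 0 < δ) (u v : ℂ) :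
    ‖truncInv δ u - truncInv δ v‖ ≤ 3 / δ ^ 2 * ‖u - v‖ := by
  set p := max ‖u‖ δ
  set q := max ‖v‖ δ
  have hp : δ ≤ p := le_max_right _ _
  have hq : δ ≤ q := le_max_right _ _
  have hp0 : 0 < p := hδ.trans_le hp
  have hq0 : 0 < q := hδ.trans_le hq
  have hpq : |q - p| ≤ ‖u - v‖ := by
    rw [abs_sub_comm]
    exact (abs_max_sub_max_le_abs _ _ _).trans (abs_norm_sub_norm_le u v)
  have hpC : (p : ℂ) ≠ 0 := by exact_mod_cast hp0.ne'
  have hqC : (q : ℂ) ≠ 0 := by exact_mod_cast hq0.ne'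
  -- Changing the numerator costs `1 / δ ^ 2`. Changing the denominator costs `2 / δ ^ 2`, because
  -- `‖v‖ ≤ q` and `u ↦ max ‖u‖ δ` is 1-Lipschitz. This gives the constant `3`.
  have e : truncInv δ u - truncInv δ v
      = starRingEnd ℂ (u - v) / (p : ℂ) ^ 2
        + starRingEnd ℂ v * (((q - p) * (q + p) / (p ^ 2 * q ^ 2) : ℝ) : ℂ) := by
    change starRingEnd ℂ u / (p : ℂ) ^ 2 - starRingEnd ℂ v / (q : ℂ) ^ 2 = _
    rw [map_sub]
    push_cast
    field_simp
    ring
  have h1 : ‖starRingEnd ℂ (u - v) / (p : ℂ) ^ 2‖ ≤ ‖u - v‖ / δ ^ 2 := by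
    rw [norm_div, norm_pow, RCLike.norm_conj, Complex.norm_real, Real.norm_of_nonneg hp0.le]
    gcongr
  have h2 : ‖starRingEnd ℂ v * (((q - p) * (q + p) / (p ^ 2 * q ^ 2) : ℝ) : ℂ)‖
      ≤ 2 * ‖u - v‖ / δ ^ 2 := by
    rw [norm_mul, RCLike.norm_conj, Complex.norm_real, Real.norm_eq_abs, abs_div, abs_mul,
      abs_of_pos (by positivity : 0 < q + p), abs_of_pos (by positivity : 0 < p ^ 2 * q ^ 2)]
    calc ‖v‖ * (|q - p| * (q + p) / (p ^ 2 * q ^ 2))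
        ≤ q * (‖u - v‖ * (q + p) / (p ^ 2 * q ^ 2)) := by
          gcongr
          exact le_max_left _ _
      _ = ‖u - v‖ * (1 / p ^ 2 + 1 / (p * q)) := by field_simp
      _ ≤ ‖u - v‖ * (1 / δ ^ 2 + 1 / (δ * δ)) := by gcongr
      _ = _ := by ring
  rw [e]
  refine (norm_add_le _ _).trans ((add_le_add h1 h2).trans_eq ?_)
  ring

theorem continuous_truncInv {δ : ℝ} (hδ : 0 < δ) : Continuous (truncInv δ) := by
  refine (LipschitzWith.of_dist_le_mul (K := Real.toNNReal (3 / δ ^ 2)) fun u v => ?_).continuous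
  rw [Real.coe_toNNReal _ (by positivity)]
  simpa only [dist_eq_norm] using norm_truncInv_sub_le hδ u v

/-- Truncating only the modulus keeps the imaginary part a nonpositive multiple of `u.im`, so the
truncated flow still respects the real line and the upper half-plane. -/
theorem truncInv_im (δ : ℝ) (u : ℂ) :
    (truncInv δ u).im = -(1 / (max ‖u‖ δ) ^ 2) * u.im := by
  rw [truncInv, ← Complex.ofReal_pow, Complex.div_ofReal_im, Complex.conj_im]
  ring

/-- The filter argument also covers `n = 0`, where there is no minimum to take. -/
theorem exists_pos_forall_le {n : ℕ} {f : Fin n → ℝ} (hf : ∀ j, 0 < f j) :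
    ∃ δ > 0, ∀ j, δ ≤ f j := by
  have h1 : ∀ᶠ δ in 𝓝[>] (0 : ℝ), ∀ j, δ ≤ f j := by
    rw [eventually_all]
    intro j
    filter_upwards [Ioo_mem_nhdsGT (hf j)] with δ hδ using hδ.2.le
  exact ((eventually_mem_nhdsWithin).and h1).exists

/-! ### Driving data and orbits -/

/-- Weights and growth points on `[0, t]` with the regularity needed for the Loewner equation. -/
structure IsDriving {n : ℕ} (ν x : ℝ → Fin n → ℝ) (t : ℝ) : Prop where
  time_nonneg : 0 ≤ t
  integrable : ∀ j, IntervalIntegrable (fun s => ν s j) volume 0 t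
  continuousOn : ContinuousOn x (Icc 0 t)

variable {n : ℕ} {ν x : ℝ → Fin n → ℝ} {t : ℝ}

theorem IsDriving.mono (h : IsDriving ν x t) {s : ℝ} (hs : s ∈ Icc 0 t) : IsDriving ν x s where
  time_nonneg := hs.1
  integrable j := (h.integrable j).mono_set
    (uIcc_subset_uIcc_left (by rwa [uIcc_of_le h.time_nonneg]))
  continuousOn := h.continuousOn.mono (Icc_subset_Icc_right hs.2)

theorem IsDriving.continuousOn_coord (h : IsDriving ν x t) (j : Fin n) :
    ContinuousOn (fun s => (x s j : ℂ)) (Icc 0 t) :=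
  Complex.continuous_ofReal.comp_continuousOn
    ((continuous_apply j).comp_continuousOn h.continuousOn)

theorem IsDriving.intervalIntegrable_sum (h : IsDriving ν x t) {c : Fin n → ℝ → ℂ}
    (hc : ∀ j, ContinuousOn (c j) (Icc 0 t)) :
    IntervalIntegrable (fun s => ∑ j, 2 * (ν s j : ℂ) * c j s) volume 0 t :=
  intervalIntegrable_fun_sum fun j _ => intervalIntegrable_mul_continuousOn h.time_nonneg
    ((intervalIntegrable_ofReal (h.integrable j)).const_mul 2) (hc j)

/-- Backward orbits are forward orbits for these data. The reversed weights are negative, which is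
why `IsDriving` imposes no sign. -/
theorem IsDriving.reverse (h : IsDriving ν x t) :
    IsDriving (fun s j => -ν (t - s) j) (fun s => x (t - s)) t where
  time_nonneg := h.time_nonneg
  integrable j := by
    refine IntervalIntegrable.neg ?_
    simpa using ((h.integrable j).comp_sub_left t).symm
  continuousOn := h.continuousOn.comp (by fun_prop) fun s hs =>
    ⟨by linarith [hs.2], by linarith [hs.1]⟩

/-- The Loewner field with the truncated inversion. -/
noncomputable def truncField (δ : ℝ) (ν x : Fin n → ℝ) (w : ℂ) : ℂ :=
  ∑ j, 2 * (ν j : ℂ) * truncInv δ (w - x j)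

theorem truncField_eq {δ : ℝ} {ν x : Fin n → ℝ} {w : ℂ} (h : ∀ j, δ ≤ ‖w - x j‖) :
    truncField δ ν x w = loewnerField ν x w := by
  refine Finset.sum_congr rfl fun j _ => ?_
  rw [truncInv_eq_inv (h j), div_eq_mul_inv]

theorem norm_truncField_le {δ : ℝ} (hδ : 0 < δ) (ν x : Fin n → ℝ) (w : ℂ) :
    ‖truncField δ ν x w‖ ≤ (∑ j, 2 * |ν j|) * (1 / δ) := by
  rw [Finset.sum_mul]
  refine (norm_sum_le _ _).trans (Finset.sum_le_sum fun j _ => ?_)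
  rw [norm_mul, norm_mul, Complex.norm_real, Complex.norm_ofNat, Real.norm_eq_abs]
  gcongr
  exact norm_truncInv_le hδ _

theorem IsDriving.exists_trunc_solution (h : IsDriving ν x t) {δ : ℝ} (hδ : 0 < δ) (z : ℂ) :
    ∃ γ : ℝ → ℂ, Continuous γ ∧
      ∀ s ∈ Icc 0 t, γ s = z + ∫ r in (0 : ℝ)..s, truncField δ (ν r) (x r) (γ r) := by
  have hsum : IntervalIntegrable (fun s => ∑ j, 2 * |ν s j|) volume 0 t :=
    intervalIntegrable_fun_sum fun j _ => (h.integrable j).abs.const_mul 2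
  refine exists_integral_solution h.time_nonneg (hsum.mul_const (3 / δ ^ 2)) ?_ ?_ z
  · intro γ hγ
    exact h.intervalIntegrable_sum fun j => (continuous_truncInv hδ).comp_continuousOn
      (hγ.continuousOn.sub (h.continuousOn_coord j))
  · intro s hs u v
    rw [truncField, truncField, ← Finset.sum_sub_distrib, Finset.sum_mul, Finset.sum_mul]
    refine (norm_sum_le _ _).trans (Finset.sum_le_sum fun j _ => ?_)
    rw [← mul_sub, norm_mul, norm_mul, Complex.norm_real, Complex.norm_ofNat, Real.norm_eq_abs,
      mul_assoc (2 * |ν s j|)]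
    gcongr
    simpa using norm_truncInv_sub_le hδ (u - x s j) (v - x s j)

/-- The imaginary part solves a linear homogeneous equation with real coefficient, so it keeps its
sign; the sign of the weights decides whether it shrinks or grows. -/
theorem IsDriving.trunc_solution_im (h : IsDriving ν x t) {δ : ℝ} (hδ : 0 < δ) {z : ℂ} {γ : ℝ → ℂ}
    (hγ : ContinuousOn γ (Icc 0 t))
    (heq : ∀ s ∈ Icc 0 t, γ s = z + ∫ r in (0 : ℝ)..s, truncField δ (ν r) (x r) (γ r)) :
    (γ t).im = z.im * Real.exp (∫ s in (0 : ℝ)..t,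
      ∑ j, 2 * ν s j * -(1 / (max ‖γ s - x s j‖ δ) ^ 2)) := by
  have hint : IntervalIntegrable (fun s => truncField δ (ν s) (x s) (γ s)) volume 0 t :=
    h.intervalIntegrable_sum fun j => (continuous_truncInv hδ).comp_continuousOn
      (hγ.sub (h.continuousOn_coord j))
  have hc : ∀ j, ContinuousOn (fun s => ((-(1 / (max ‖γ s - x s j‖ δ) ^ 2) : ℝ) : ℂ)) (Icc 0 t) := by
    intro j
    refine Complex.continuous_ofReal.comp_continuousOn (ContinuousOn.neg (ContinuousOn.div
      continuousOn_const ((ContinuousOn.sup (hγ.sub (h.continuousOn_coord j)).norm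
        continuousOn_const).pow 2) fun s _ => ?_))
    have : 0 < max ‖γ s - x s j‖ δ := lt_max_of_lt_right hδ
    exact pow_ne_zero _ this.ne'
  have hlin := eq_mul_exp_of_linear (d := fun s => ((γ s).im : ℂ)) (d₀ := (z.im : ℂ))
    h.time_nonneg (h.intervalIntegrable_sum hc)
    (Complex.continuous_ofReal.comp_continuousOn (Complex.continuous_im.comp_continuousOn hγ)) (by
      intro s hs
      have hint' := hint.mono_set (uIcc_subset_uIcc_left (a := (0 : ℝ)) (x := s)
        (by rwa [uIcc_of_le h.time_nonneg]))
      have e1 := Complex.imCLM.intervalIntegral_comp_comm hint'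
      simp only [Complex.imCLM_apply] at e1
      rw [heq s hs, Complex.add_im, ← e1, Complex.ofReal_add, ← intervalIntegral.integral_ofReal]
      congr 1
      refine intervalIntegral.integral_congr fun r hr => ?_
      simp only [truncField, Complex.im_sum]
      push_cast
      rw [Finset.sum_mul]
      refine Finset.sum_congr rfl fun j _ => ?_
      have : (2 * (ν r j : ℂ)) = ((2 * ν r j : ℝ) : ℂ) := by push_cast; rfl
      rw [this, Complex.im_ofReal_mul, truncInv_im]
      simp
      ring)
  have e2 : (∫ s in (0 : ℝ)..t, ∑ j, 2 * (ν s j : ℂ) *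
      ((-(1 / (max ‖γ s - x s j‖ δ) ^ 2) : ℝ) : ℂ))
      = ((∫ s in (0 : ℝ)..t, ∑ j, 2 * ν s j * -(1 / (max ‖γ s - x s j‖ δ) ^ 2) : ℝ) : ℂ) := by
    rw [← intervalIntegral.integral_ofReal]
    push_cast
    rfl
  rw [e2, ← Complex.ofReal_exp, ← Complex.ofReal_mul] at hlin
  exact_mod_cast hlin

namespace IsLoewnerOrbit

variable {z z₁ z₂ : ℂ} {γ γ₁ γ₂ : ℝ → ℂ}

theorem mono (h : IsLoewnerOrbit ν x z t γ) {s : ℝ} (hs : s ≤ t) : IsLoewnerOrbit ν x z s γ where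
  continuousOn := h.continuousOn.mono (Icc_subset_Icc_right hs)
  ne_growth r hr := h.ne_growth r ⟨hr.1, hr.2.trans hs⟩
  eq_integral r hr := h.eq_integral r ⟨hr.1, hr.2.trans hs⟩

theorem apply_zero (h : IsLoewnerOrbit ν x z t γ) (ht : 0 ≤ t) : γ 0 = z := by
  simpa using h.eq_integral 0 ⟨le_rfl, ht⟩

theorem continuousOn_inv (h : IsLoewnerOrbit ν x z t γ) (hd : IsDriving ν x t) (j : Fin n) :
    ContinuousOn (fun s => (γ s - x s j)⁻¹) (Icc 0 t) :=
  (h.continuousOn.sub (hd.continuousOn_coord j)).inv₀ fun s hs =>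
    sub_ne_zero.mpr (h.ne_growth s hs j)

theorem exists_dist_le (h : IsLoewnerOrbit ν x z t γ) (hd : IsDriving ν x t) :
    ∃ δ > 0, ∀ j, ∀ s ∈ Icc 0 t, δ ≤ ‖γ s - x s j‖ := by
  have : ∀ j, ∃ δ > 0, ∀ s ∈ Icc 0 t, δ ≤ ‖γ s - x s j‖ := by
    intro j
    obtain ⟨s₀, hs₀, hmin⟩ := isCompact_Icc.exists_isMinOn (nonempty_Icc.mpr hd.time_nonneg)
      (h.continuousOn.sub (hd.continuousOn_coord j)).norm
    exact ⟨_, norm_pos_iff.mpr (sub_ne_zero.mpr (h.ne_growth s₀ hs₀ j)), fun s hs => hmin hs⟩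
  choose f hf0 hf using this
  obtain ⟨δ, hδ, hle⟩ := exists_pos_forall_le hf0
  exact ⟨δ, hδ, fun j s hs => (hle j).trans (hf j s hs)⟩

theorem intervalIntegrable_field (h : IsLoewnerOrbit ν x z t γ) (hd : IsDriving ν x t) :
    IntervalIntegrable (fun s => loewnerField (ν s) (x s) (γ s)) volume 0 t := by
  have := hd.intervalIntegrable_sum fun j => h.continuousOn_inv hd j
  simpa only [loewnerField, div_eq_mul_inv] using this

end IsLoewnerOrbit

theorem orbit_of_trunc {δ : ℝ} (hδ : 0 < δ) {z : ℂ} {γ : ℝ → ℂ}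
    (hγ : ContinuousOn γ (Icc 0 t))
    (heq : ∀ s ∈ Icc 0 t, γ s = z + ∫ r in (0 : ℝ)..s, truncField δ (ν r) (x r) (γ r))
    (hfar : ∀ s ∈ Icc 0 t, ∀ j, δ ≤ ‖γ s - x s j‖) : IsLoewnerOrbit ν x z t γ where
  continuousOn := hγ
  ne_growth s hs j := sub_ne_zero.mp (norm_pos_iff.mp (hδ.trans_le (hfar s hs j)))
  eq_integral s hs := by
    rw [heq s hs]
    congr 1
    refine intervalIntegral.integral_congr fun r hr => truncField_eq fun j => hfar r ?_ j
    rw [uIcc_of_le hs.1] at hr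
    exact ⟨hr.1, hr.2.trans hs.2⟩

/-- The rate at which two orbits at `u` and `v` approach each other. -/
noncomputable def orbitRate (ν x : Fin n → ℝ) (u v : ℂ) : ℂ :=
  ∑ j, 2 * (ν j : ℂ) * ((u - x j)⁻¹ * (v - x j)⁻¹)

theorem loewnerField_sub {ν x : Fin n → ℝ} {u v : ℂ} (hu : ∀ j, u ≠ x j) (hv : ∀ j, v ≠ x j) :
    loewnerField ν x u - loewnerField ν x v = -orbitRate ν x u v * (u - v) := by
  rw [loewnerField, loewnerField, orbitRate, ← Finset.sum_sub_distrib, neg_mul, Finset.sum_mul,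
    ← Finset.sum_neg_distrib]
  refine Finset.sum_congr rfl fun j _ => ?_
  have h1 := sub_ne_zero.mpr (hu j)
  have h2 := sub_ne_zero.mpr (hv j)
  field_simp
  ring

namespace IsLoewnerOrbit

variable {z z₁ z₂ : ℂ} {γ γ₁ γ₂ : ℝ → ℂ}

theorem intervalIntegrable_orbitRate (h₁ : IsLoewnerOrbit ν x z₁ t γ₁)
    (h₂ : IsLoewnerOrbit ν x z₂ t γ₂) (hd : IsDriving ν x t) :
    IntervalIntegrable (fun s => orbitRate (ν s) (x s) (γ₁ s) (γ₂ s)) volume 0 t :=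
  hd.intervalIntegrable_sum fun j => (h₁.continuousOn_inv hd j).mul (h₂.continuousOn_inv hd j)

/-- The difference of two orbits solves a linear equation with coefficient `-orbitRate`. Uniqueness,
injectivity of the flow and the derivative of its inverse all follow from this formula. -/
theorem sub_eq (h₁ : IsLoewnerOrbit ν x z₁ t γ₁) (h₂ : IsLoewnerOrbit ν x z₂ t γ₂)
    (hd : IsDriving ν x t) :
    γ₁ t - γ₂ t = (z₁ - z₂) *
      Complex.exp (∫ s in (0 : ℝ)..t, -orbitRate (ν s) (x s) (γ₁ s) (γ₂ s)) := by
  refine eq_mul_exp_of_linear (d := fun s => γ₁ s - γ₂ s) hd.time_nonneg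
    (h₁.intervalIntegrable_orbitRate h₂ hd).neg (h₁.continuousOn.sub h₂.continuousOn) ?_
  intro s hs
  have hds := hd.mono hs
  have e1 := (h₁.mono hs.2).intervalIntegrable_field hds
  have e2 := (h₂.mono hs.2).intervalIntegrable_field hds
  rw [h₁.eq_integral s hs, h₂.eq_integral s hs, add_sub_add_comm,
    ← intervalIntegral.integral_sub e1 e2]
  congr 1
  refine intervalIntegral.integral_congr fun r hr => ?_
  rw [uIcc_of_le hs.1] at hr
  have hr' : r ∈ Icc 0 t := ⟨hr.1, hr.2.trans hs.2⟩
  exact loewnerField_sub (h₁.ne_growth r hr') (h₂.ne_growth r hr')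

theorem unique (h₁ : IsLoewnerOrbit ν x z t γ₁) (h₂ : IsLoewnerOrbit ν x z t γ₂)
    (hd : IsDriving ν x t) : γ₁ t = γ₂ t := by
  have := h₁.sub_eq h₂ hd
  rwa [sub_self, zero_mul, sub_eq_zero] at this

theorem start_eq (h₁ : IsLoewnerOrbit ν x z₁ t γ₁) (h₂ : IsLoewnerOrbit ν x z₂ t γ₂)
    (hd : IsDriving ν x t) (h : γ₁ t = γ₂ t) : z₁ = z₂ := by
  have := h₁.sub_eq h₂ hd
  rw [h, sub_self, eq_comm, mul_eq_zero, sub_eq_zero] at this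
  exact this.resolve_right (Complex.exp_ne_zero _)

theorem conj (h : IsLoewnerOrbit ν x z t γ) (hd : IsDriving ν x t) :
    IsLoewnerOrbit ν x (starRingEnd ℂ z) t (fun s => starRingEnd ℂ (γ s)) where
  continuousOn := Complex.continuous_conj.comp_continuousOn h.continuousOn
  ne_growth s hs j e := h.ne_growth s hs j (by
    simpa using congrArg (starRingEnd ℂ) e)
  eq_integral s hs := by
    have e1 := Complex.conjCLE.toContinuousLinearMap.intervalIntegral_comp_comm
      ((h.mono hs.2).intervalIntegrable_field (hd.mono hs))
    simp only [ContinuousLinearEquiv.coe_coe, Complex.conjCLE_apply] at e1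
    rw [h.eq_integral s hs, map_add, ← e1]
    congr 1
    refine intervalIntegral.integral_congr fun r _ => ?_
    simp [loewnerField, map_sum, map_ofNat]

theorem im_pos (h : IsLoewnerOrbit ν x z t γ) (hd : IsDriving ν x t) (hz : 0 < z.im) :
    0 < (γ t).im := by
  obtain ⟨δ, hδ, hfar⟩ := h.exists_dist_le hd
  rw [hd.trunc_solution_im hδ h.continuousOn (z := z) ?_]
  · positivity
  · intro s hs
    rw [h.eq_integral s hs]
    congr 1
    refine intervalIntegral.integral_congr fun r hr => (truncField_eq fun j => hfar j r ?_).symm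
    rw [uIcc_of_le hs.1] at hr
    exact ⟨hr.1, hr.2.trans hs.2⟩

end IsLoewnerOrbit

/-- Either the orbit exists up to time `t`, or it exists until it comes within distance `δ` of a
growth point. -/
theorem IsDriving.exists_orbit_or_near (h : IsDriving ν x t) {δ : ℝ} (hδ : 0 < δ) {z : ℂ}
    (hz : ∀ j, δ ≤ ‖z - x 0 j‖) :
    (∃ γ, IsLoewnerOrbit ν x z t γ) ∨
      ∃ s ∈ Icc 0 t, ∃ γ, IsLoewnerOrbit ν x z s γ ∧ ∃ j, ‖γ s - x s j‖ ≤ δ := by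
  obtain ⟨η, hη, heq⟩ := h.exists_trunc_solution hδ z
  have hη0 : η 0 = z := by simpa using heq 0 ⟨le_rfl, h.time_nonneg⟩
  have hcont : ∀ j, ContinuousOn (fun s => ‖η s - x s j‖) (Icc 0 t) := fun j =>
    (hη.continuousOn.sub (h.continuousOn_coord j)).norm
  -- The times at which the truncated solution is within `δ` of a growth point. Up to the first of
  -- them it is a genuine orbit.
  let B : Set ℝ := ⋃ j, {s ∈ Icc 0 t | ‖η s - x s j‖ ≤ δ}
  have hB : IsCompact B := isCompact_iUnion fun j => isCompact_Icc.of_isClosed_subset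
    ((hcont j).preimage_isClosed_of_isClosed isClosed_Icc isClosed_Iic) fun s hs => hs.1
  by_cases hne : B.Nonempty
  · right
    obtain ⟨s₀, hs₀, hmin⟩ := hB.exists_isLeast hne
    obtain ⟨i, hi⟩ := mem_iUnion.mp hs₀
    have hlt : ∀ s ∈ Ico 0 s₀, ∀ j, δ < ‖η s - x s j‖ := by
      intro s hs j
      by_contra hle
      exact absurd (hmin (mem_iUnion.mpr ⟨j, ⟨hs.1, hs.2.le.trans hi.1.2⟩, not_lt.mp hle⟩))
        (not_le.mpr hs.2)
    have hfar : ∀ s ∈ Icc 0 s₀, ∀ j, δ ≤ ‖η s - x s j‖ := by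
      intro s hs j
      rcases hs.2.lt_or_eq with hlt' | rfl
      · exact (hlt s ⟨hs.1, hlt'⟩ j).le
      · rcases hs.1.eq_or_lt with h0 | h0
        · rw [← h0, hη0]; exact hz j
        -- At the first bad time itself the lower bound passes to the limit from the left.
        · have hcl : s ∈ closure (Ico 0 s) := by
            rw [closure_Ico h0.ne]; exact hs
          have hcw : ContinuousWithinAt (fun s => ‖η s - x s j‖) (Ico 0 s) s :=
            ((hcont j) s hi.1).mono fun r hr => ⟨hr.1, hr.2.le.trans hi.1.2⟩
          have : (𝓝[Ico 0 s] s).NeBot := mem_closure_iff_nhdsWithin_neBot.mp hcl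
          exact ge_of_tendsto hcw (eventually_mem_nhdsWithin.mono fun r hr => (hlt r hr j).le)
    exact ⟨s₀, hi.1, η, orbit_of_trunc hδ hη.continuousOn
      (fun s hs => heq s ⟨hs.1, hs.2.trans hi.1.2⟩) hfar, i, hi.2⟩
  · left
    refine ⟨η, orbit_of_trunc hδ hη.continuousOn heq fun s hs j => ?_⟩
    by_contra hle
    exact hne ⟨s, mem_iUnion.mpr ⟨j, hs, (not_le.mp hle).le⟩⟩

/-- An orbit that does not survive comes arbitrarily close to the growth points. -/
theorem IsDriving.exists_near_of_not_exists_orbit (h : IsDriving ν x t) {z : ℂ}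
    (hz : ∀ j, z ≠ x 0 j) (hno : ¬ ∃ γ, IsLoewnerOrbit ν x z t γ) {ε : ℝ} (hε : 0 < ε) :
    ∃ s ∈ Icc 0 t, ∃ γ, IsLoewnerOrbit ν x z s γ ∧ ∃ j, ‖γ s - x s j‖ ≤ ε := by
  obtain ⟨δ, hδ, hle⟩ := exists_pos_forall_le
    fun j => norm_pos_iff.mpr (sub_ne_zero.mpr (hz j))
  obtain ⟨s, hs, γ, hγ, j, hj⟩ := (h.exists_orbit_or_near (lt_min hδ hε)
    fun j => (min_le_left _ _).trans (hle j)).resolve_left hno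
  exact ⟨s, hs, γ, hγ, j, hj.trans (min_le_right _ _)⟩

/-- Orbits can be continued. -/
theorem IsLoewnerOrbit.exists_continuation {z : ℂ} {γ : ℝ → ℂ} (h : IsLoewnerOrbit ν x z t γ)
    {t' : ℝ} (hd : IsDriving ν x t') (ht : 0 ≤ t) (htt : t < t') :
    ∃ s > t, ∃ η, IsLoewnerOrbit ν x z s η := by
  have hdt := hd.mono ⟨ht, htt.le⟩
  obtain ⟨δ, hδ, hfar⟩ := h.exists_dist_le hdt
  -- With threshold `δ / 2` the new orbit cannot stop at a time `s ≤ t`: by uniqueness it equals `γ`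
  -- there, which stays at distance at least `δ`.
  rcases hd.exists_orbit_or_near (half_pos hδ) (z := z) (fun j => by
    have := hfar j 0 ⟨le_rfl, ht⟩
    rw [h.apply_zero ht] at this
    linarith) with ⟨η, hη⟩ | ⟨s, hs, η, hη, j, hj⟩
  · exact ⟨t', htt, η, hη⟩
  · refine ⟨s, ?_, η, hη⟩
    by_contra! hle
    have := hfar j s ⟨hs.1, hle⟩
    rw [(h.mono hle).unique hη (hd.mono hs)] at this
    linarith

/-- Lying outside the hull means `t < τ_z` strictly, so an orbit on `[0, t]` has to be continued a
little further. The driving data up to `t' > t` make this possible. -/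
theorem mem_upperHalf_diff_hull {t' : ℝ} (hd : IsDriving ν x t') (ht : 0 ≤ t) (htt : t < t') {z : ℂ} :
    z ∈ upperHalf \ hull ν x t ↔ 0 < z.im ∧ ∃ γ, IsLoewnerOrbit ν x z t γ := by
  simp only [upperHalf, hull, Set.mem_sdiff, mem_ofPred_eq, not_and, not_le]
  constructor
  · rintro ⟨hz, hlt⟩
    refine ⟨hz, ?_⟩
    have := hlt hz.le
    simp only [swallowingTime, lt_iSup_iff] at this
    obtain ⟨r, ⟨γ, hγ⟩, hr⟩ := this
    refine ⟨γ, hγ.mono ?_⟩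
    rw [ENNReal.ofReal_lt_coe_iff ht] at hr
    exact hr.le
  · rintro ⟨hz, γ, hγ⟩
    refine ⟨hz, fun _ => ?_⟩
    obtain ⟨s, hs, η, hη⟩ := hγ.exists_continuation hd ht htt
    simp only [swallowingTime, lt_iSup_iff]
    refine ⟨s.toNNReal, ⟨η, ?_⟩, (ENNReal.ofReal_lt_ofReal_iff (ht.trans_lt hs)).mpr hs⟩
    rwa [Real.coe_toNNReal _ (ht.trans hs.le)]

theorem flowMap_eq (hd : IsDriving ν x t) {z : ℂ} {γ : ℝ → ℂ} (h : IsLoewnerOrbit ν x z t γ) :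
    flowMap ν x t z = γ t := by
  have hex : ∃ γ, IsLoewnerOrbit ν x z t γ := ⟨γ, h⟩
  rw [flowMap, dif_pos hex]
  exact hex.choose_spec.unique h hd

/-! ### Backward orbits -/

theorem IsDriving.orbit_of_backward_trunc (h : IsDriving ν x t) {δ : ℝ} (hδ : 0 < δ) {w : ℂ}
    {η : ℝ → ℂ} (hη : Continuous η)
    (heq : ∀ s ∈ Icc 0 t, η s = w + ∫ r in (0 : ℝ)..s,
      truncField δ (fun j => -ν (t - r) j) (x (t - r)) (η r))
    (hfar : ∀ s ∈ Icc 0 t, ∀ j, δ ≤ ‖η s - x (t - s) j‖) :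
    IsLoewnerOrbit ν x (η t) t (fun s => η (t - s)) := by
  have h₁ := orbit_of_trunc hδ hη.continuousOn heq hfar
  refine ⟨(hη.comp (continuous_const.sub continuous_id)).continuousOn, fun s hs j e => ?_,
    fun s hs => ?_⟩
  · have := h₁.ne_growth (t - s) ⟨by linarith [hs.2], by linarith [hs.1]⟩ j
    simp only [sub_sub_cancel] at this
    exact this e
  · have hts : t - s ∈ Icc 0 t := ⟨by linarith [hs.2], by linarith [hs.1]⟩
    have i1 := h₁.intervalIntegrable_field h.reverse
    have i2 := (h₁.mono hts.2).intervalIntegrable_field (h.reverse.mono hts)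
    have e1 := h₁.eq_integral (t - s) hts
    have e2 := h₁.eq_integral t ⟨h.time_nonneg, le_rfl⟩
    have e3 := intervalIntegral.integral_interval_sub_left i1 i2
    -- Substituting `r ↦ t - r`; the sign in the reversed weights produces the minus sign.
    have e4 : (∫ r in (0 : ℝ)..s, loewnerField (ν r) (x r) (η (t - r)))
        = -∫ r in (t - s)..t, loewnerField (fun j => -ν (t - r) j) (x (t - r)) (η r) := by
      have := intervalIntegral.integral_comp_sub_left (a := 0) (b := s)
        (fun r => loewnerField (fun j => -ν (t - r) j) (x (t - r)) (η r)) t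
      rw [sub_zero] at this
      rw [← this, ← intervalIntegral.integral_neg]
      refine intervalIntegral.integral_congr fun r _ => ?_
      simp [loewnerField, neg_div]
    rw [e4, ← e3, e1, e2]
    ring

/-- Backward in time the imaginary part does not decrease, so the solution stays at height at least
`w.im` and the truncation at `δ ≤ w.im` is never active. -/
theorem IsDriving.exists_backward_of_im (h : IsDriving ν x t)
    (hν : ∀ s ∈ Icc 0 t, ∀ j, 0 ≤ ν s j) {w : ℂ} {δ : ℝ} (hδ : 0 < δ) (hw : δ ≤ w.im) :
    ∃ γ z, IsLoewnerOrbit ν x z t γ ∧ γ t = w ∧ 0 < z.im ∧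
      ∀ s ∈ Icc 0 t, ∀ j, δ ≤ ‖γ s - x s j‖ := by
  obtain ⟨η, hη, heq⟩ := h.reverse.exists_trunc_solution hδ w
  have him : ∀ s ∈ Icc 0 t, w.im ≤ (η s).im := by
    intro s hs
    rw [(h.reverse.mono hs).trunc_solution_im hδ hη.continuousOn
      (fun r hr => heq r ⟨hr.1, hr.2.trans hs.2⟩)]
    refine le_mul_of_one_le_right (hδ.le.trans hw) (Real.one_le_exp
      (intervalIntegral.integral_nonneg hs.1 fun r hr => Finset.sum_nonneg fun j _ => ?_))
    have := hν (t - r) ⟨by linarith [hr.2, hs.2], by linarith [hr.1]⟩ j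
    rw [mul_neg, mul_neg, neg_mul, neg_neg]
    positivity
  have hfar : ∀ s ∈ Icc 0 t, ∀ j, δ ≤ ‖η s - x (t - s) j‖ := by
    intro s hs j
    refine (hw.trans (him s hs)).trans ?_
    simpa using (le_abs_self _).trans (Complex.abs_im_le_norm (η s - x (t - s) j))
  have horb := h.orbit_of_backward_trunc hδ hη heq hfar
  refine ⟨_, _, horb, ?_, (hδ.trans_le hw).trans_le (him t ⟨h.time_nonneg, le_rfl⟩),
    fun s hs j => ?_⟩
  · simpa using heq 0 ⟨le_rfl, h.time_nonneg⟩
  · simpa using hfar (t - s) ⟨by linarith [hs.2], by linarith [hs.1]⟩ j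

/-- The growth points stay bounded, and backward orbits starting sufficiently far to the right
move by a bounded amount. -/
theorem IsDriving.exists_backward_of_re (h : IsDriving ν x t) :
    ∃ Λ : ℝ, 0 ≤ Λ ∧ ∀ M : ℝ, (∀ s ∈ Icc 0 t, ∀ j, x s j ≤ M) → ∀ w : ℂ, M + 1 + Λ ≤ w.re →
      ∃ γ z, IsLoewnerOrbit ν x z t γ ∧ γ t = w ∧ (∀ s ∈ Icc 0 t, ∀ j, 1 ≤ ‖γ s - x s j‖) ∧
        ‖z - w‖ ≤ Λ ∧ (w.im = 0 → z.im = 0) := by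
  have hr := h.reverse
  have hsum : IntervalIntegrable (fun s => ∑ j, 2 * |(-ν (t - s) j)|) volume 0 t :=
    intervalIntegrable_fun_sum fun j _ => (hr.integrable j).abs.const_mul 2
  refine ⟨∫ s in (0 : ℝ)..t, ∑ j, 2 * |(-ν (t - s) j)|,
    intervalIntegral.integral_nonneg h.time_nonneg fun s _ =>
      Finset.sum_nonneg fun j _ => by positivity, fun M hM w hw => ?_⟩
  -- With truncation at distance `1` the field is bounded by `∑ 2 |ν_j|`, so `Λ` bounds the total
  -- displacement. A start at real part `M + 1 + Λ` or more therefore keeps distance at least `1`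
  -- from every growth point.
  set Λ := ∫ s in (0 : ℝ)..t, ∑ j, 2 * |(-ν (t - s) j)|
  obtain ⟨η, hη, heq⟩ := hr.exists_trunc_solution one_pos w
  have hdisp : ∀ s ∈ Icc 0 t, ‖η s - w‖ ≤ Λ := by
    intro s hs
    rw [heq s hs, add_sub_cancel_left]
    calc _ ≤ ∫ r in (0 : ℝ)..s, ∑ j, 2 * |(-ν (t - r) j)| := by
          refine intervalIntegral.norm_integral_le_of_norm_le hs.1 (Eventually.of_forall
            fun r _ => ?_) (hsum.mono_set (uIcc_subset_uIcc_left (by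
              rwa [uIcc_of_le h.time_nonneg])))
          simpa using norm_truncField_le one_pos (fun j => -ν (t - r) j) (x (t - r)) (η r)
      _ ≤ Λ := by
          refine intervalIntegral.integral_mono_interval le_rfl hs.1 hs.2
            (Eventually.of_forall fun r => ?_) hsum
          exact Finset.sum_nonneg fun j _ => by positivity
  have hfar : ∀ s ∈ Icc 0 t, ∀ j, 1 ≤ ‖η s - x (t - s) j‖ := by
    intro s hs j
    have e1 := (Complex.abs_re_le_norm (η s - w)).trans (hdisp s hs)
    have e2 := hM (t - s) ⟨by linarith [hs.2], by linarith [hs.1]⟩ j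
    refine le_trans ?_ ((le_abs_self _).trans (Complex.abs_re_le_norm (η s - x (t - s) j)))
    rw [Complex.sub_re, abs_le] at e1
    rw [Complex.sub_re, Complex.ofReal_re]
    linarith [e1.1]
  have horb := h.orbit_of_backward_trunc one_pos hη heq hfar
  have htt : t ∈ Icc 0 t := ⟨h.time_nonneg, le_rfl⟩
  refine ⟨_, _, horb, ?_, fun s hs j => ?_, hdisp t htt, fun hw0 => ?_⟩
  · simpa using heq 0 ⟨le_rfl, h.time_nonneg⟩
  · simpa using hfar (t - s) ⟨by linarith [hs.2], by linarith [hs.1]⟩ j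
  · rw [hr.trunc_solution_im one_pos hη.continuousOn heq, hw0, zero_mul]

end

section

/-! ### Invariants of the multiple flow -/

/-- The logarithmic derivative of `w - x j` along the flow. -/
noncomputable def growthRate {n m : ℕ} (ν x : Fin n → ℝ) (ξ : Fin m → ℂ) (w : ℂ) (j : Fin n) : ℂ :=
  2 * (ν j : ℂ) * ((w - x j)⁻¹) ^ 2
    - ∑ k ∈ Finset.univ.erase j, 2 * (ν k : ℂ) * ((w - x k)⁻¹ * ((x j : ℂ) - x k)⁻¹)
    - (ν j : ℂ) * (dlogZ x ξ j * (w - x j)⁻¹)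

/-- For `k ≠ j` the difference of `1 / (w - x k)` and `1 / (x j - x k)` contains the factor `w - x
j`. -/
theorem loewnerField_sub_growth {n m : ℕ} {ν x : Fin n → ℝ} {ξ : Fin m → ℂ} {w : ℂ}
    (hx : Function.Injective x) (hw : ∀ j, w ≠ x j) (j : Fin n) :
    loewnerField ν x w - ((ν j : ℂ) * dlogZ x ξ j
        + ∑ k ∈ Finset.univ.erase j, 2 * (ν k : ℂ) / ((x j : ℂ) - x k))
      = growthRate ν x ξ w j * (w - x j) := by
  have hj := sub_ne_zero.mpr (hw j)
  rw [loewnerField, ← Finset.add_sum_erase _ _ (Finset.mem_univ j), growthRate, sub_mul, sub_mul,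
    Finset.sum_mul]
  have e : ∑ k ∈ Finset.univ.erase j, 2 * (ν k : ℂ) * ((w - x k)⁻¹ * ((x j : ℂ) - x k)⁻¹) * (w - x j)
      = ∑ k ∈ Finset.univ.erase j, 2 * (ν k : ℂ) / ((x j : ℂ) - x k)
        - ∑ k ∈ Finset.univ.erase j, 2 * (ν k : ℂ) / (w - x k) := by
    rw [← Finset.sum_sub_distrib]
    refine Finset.sum_congr rfl fun k hk => ?_
    have hk' : (x j : ℂ) - x k ≠ 0 := by
      rw [sub_ne_zero]
      exact_mod_cast fun h => Finset.ne_of_mem_erase hk (hx h).symm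
    have := sub_ne_zero.mpr (hw k)
    field_simp
    ring
  rw [e]
  field_simp
  ring

/-- Swapping the double sum collects everything multiplying a given `ν j`; the two identities that
follow are then checked for each `ν j` separately. -/
theorem sum_growthRate_mul {n m : ℕ} (ν x : Fin n → ℝ) (ξ : Fin m → ℂ) (w : ℂ) (c : Fin n → ℂ) :
    ∑ j, growthRate ν x ξ w j * c j
      = ∑ j, (ν j : ℂ) * (2 * ((w - x j)⁻¹) ^ 2 * c j
        - ∑ i ∈ Finset.univ.erase j, 2 * (w - x j)⁻¹ * c i * ((x i : ℂ) - x j)⁻¹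
        - dlogZ x ξ j * (w - x j)⁻¹ * c j) := by
  have hswap : ∑ j, ∑ k ∈ Finset.univ.erase j,
        2 * (ν k : ℂ) * ((w - x k)⁻¹ * ((x j : ℂ) - x k)⁻¹) * c j
      = ∑ j, ∑ i ∈ Finset.univ.erase j,
        (ν j : ℂ) * (2 * (w - x j)⁻¹ * c i * ((x i : ℂ) - x j)⁻¹) := by
    rw [Finset.sum_comm' (t' := Finset.univ) (s' := fun k => Finset.univ.erase k)
      (by simp [eq_comm])]
    exact Finset.sum_congr rfl fun j _ => Finset.sum_congr rfl fun i _ => by ring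
  simp only [growthRate, sub_mul, Finset.sum_mul, mul_sub, Finset.mul_sum]
  rw [Finset.sum_sub_distrib, Finset.sum_sub_distrib, Finset.sum_sub_distrib,
    Finset.sum_sub_distrib, hswap]
  congr 1
  · congr 1
    exact Finset.sum_congr rfl fun j _ => by ring
  · exact Finset.sum_congr rfl fun j _ => by ring

/-- The left side is the logarithmic derivative of `P / Q ^ 2` along an orbit. The coefficients `2`
and `4` in `dlogZ` are the ones that cancel the growth-growth and growth-charge interactions,
leaving only the double poles. -/
theorem sum_growthRate_add {n m : ℕ} {ν x : Fin n → ℝ} {ξ : Fin m → ℂ} {w : ℂ} :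
    ∑ j, growthRate ν x ξ w j + 2 * ∑ k, orbitRate ν x w (ξ k) = orbitRate ν x w w := by
  have e := sum_growthRate_mul ν x ξ w 1
  simp only [Pi.one_apply, mul_one] at e
  rw [e]
  simp only [orbitRate]
  rw [Finset.sum_comm, Finset.mul_sum, ← Finset.sum_add_distrib]
  refine Finset.sum_congr rfl fun j _ => ?_
  have h1 : ∑ i ∈ Finset.univ.erase j, 2 * (w - x j)⁻¹ * ((x i : ℂ) - x j)⁻¹
      = -(∑ i ∈ Finset.univ.erase j, 2 / ((x j : ℂ) - x i)) * (w - x j)⁻¹ := by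
    rw [neg_mul, Finset.sum_mul, ← Finset.sum_neg_distrib]
    refine Finset.sum_congr rfl fun i _ => ?_
    rw [← neg_sub (x j : ℂ) (x i : ℂ), inv_neg]
    ring
  have h2 : ∑ l, 2 * (ν j : ℂ) * ((w - x j)⁻¹ * (ξ l - x j)⁻¹)
      = -(ν j : ℂ) * (∑ l, 4 / ((x j : ℂ) - ξ l)) * (w - x j)⁻¹ / 2 := by
    rw [Finset.mul_sum, Finset.sum_mul, Finset.sum_div]
    refine Finset.sum_congr rfl fun l _ => ?_
    rw [← neg_sub (x j : ℂ) (ξ l), inv_neg]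
    ring
  rw [h1, h2, dlogZ]
  ring

/-- The left side is the time derivative of the `k`-th stationary expression, since `1 / (ξ k - x
j)` and `1 / (ξ k - ξ l)` have logarithmic derivatives `-growthRate` and `orbitRate`. Being a
multiple of the expression itself, it keeps the value zero. -/
theorem stationary_rate {n m : ℕ} {ν x : Fin n → ℝ} {ξ : Fin m → ℂ} (hc : NoCollision x ξ)
    (k : Fin m) :
    -(∑ j, -growthRate ν x ξ (ξ k) j * (1 / (ξ k - x j)))
      + ∑ l ∈ Finset.univ.erase k, 2 * (orbitRate ν x (ξ k) (ξ l) * (1 / (ξ k - ξ l)))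
    = orbitRate ν x (ξ k) (ξ k) *
      (-(∑ j, 1 / (ξ k - x j)) + ∑ l ∈ Finset.univ.erase k, 2 / (ξ k - ξ l)) := by
  have e := sum_growthRate_mul ν x ξ (ξ k) fun j => 1 / (ξ k - x j)
  simp only [neg_mul, Finset.sum_neg_distrib, neg_neg]
  rw [e]
  simp only [orbitRate, Finset.sum_mul, Finset.mul_sum]
  rw [Finset.sum_comm, ← Finset.sum_add_distrib]
  refine Finset.sum_congr rfl fun j _ => ?_
  have hkj := sub_ne_zero.mpr (hc.mixed j k)
  have h1 : ∑ i ∈ Finset.univ.erase j,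
        2 * (ξ k - x j)⁻¹ * (1 / (ξ k - x i)) * ((x i : ℂ) - x j)⁻¹
      = ∑ i ∈ Finset.univ.erase j, (2 * ((ξ k - x j)⁻¹) ^ 2 * (1 / (ξ k - x i))
        - 2 / ((x j : ℂ) - x i) * ((ξ k - x j)⁻¹) ^ 2) := by
    refine Finset.sum_congr rfl fun i hi => ?_
    have h1 := sub_ne_zero.mpr (hc.mixed i k)
    have h2 : (x i : ℂ) - x j ≠ 0 := by
      rw [sub_ne_zero]
      exact_mod_cast fun h => Finset.ne_of_mem_erase hi (hc.growth h)
    have h3 : (x j : ℂ) - x i ≠ 0 := by rw [← neg_sub]; exact neg_ne_zero.mpr h2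
    field_simp
    ring
  have h2 : ∑ l ∈ Finset.univ.erase k,
        2 * (2 * (ν j : ℂ) * ((ξ k - x j)⁻¹ * (ξ l - x j)⁻¹) * (1 / (ξ k - ξ l)))
      = ∑ l ∈ Finset.univ.erase k,
        (ν j : ℂ) * ((ξ k - x j)⁻¹ ^ 2 * (2 * (2 / (ξ k - ξ l)) - 4 / ((x j : ℂ) - ξ l))) := by
    refine Finset.sum_congr rfl fun l hl => ?_
    have h1 := sub_ne_zero.mpr (hc.mixed j l)
    have h2 : ξ k - ξ l ≠ 0 :=
      sub_ne_zero.mpr fun h => Finset.ne_of_mem_erase hl (hc.charges h).symm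
    have h3 : (x j : ℂ) - ξ l ≠ 0 := by rw [← neg_sub]; exact neg_ne_zero.mpr h1
    field_simp
    ring
  -- The terms `l = k` and `j` are split off because they produce the cubes of `(ξ k - x j)⁻¹`: the
  -- coefficients `2` and `-4` add up to the `-2` on the right.
  rw [h1, dlogZ, ← Finset.add_sum_erase _ (fun l => 4 / ((x j : ℂ) - ξ l)) (Finset.mem_univ k),
    ← Finset.add_sum_erase _ (fun j => 1 / (ξ k - x j)) (Finset.mem_univ j)]
  simp only [← Finset.mul_sum, Finset.sum_sub_distrib, ← Finset.sum_mul] at h2 ⊢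
  rw [h2]
  have h3 : (x j : ℂ) - ξ k ≠ 0 := by rw [← neg_sub]; exact neg_ne_zero.mpr hkj
  have h4 : 4 / ((x j : ℂ) - ξ k) = -(4 * (ξ k - x j)⁻¹) := by
    rw [← neg_sub (ξ k) (x j : ℂ), div_neg, div_eq_mul_inv]
  rw [h4, one_div]
  ring

variable {n m : ℕ} {ν x : ℝ → Fin n → ℝ} {ξ : ℝ → Fin m → ℂ} {x₀ : Fin n → ℝ} {ξ₀ : Fin m → ℂ}
  {t T : ℝ}

namespace IsMultipleFlow

theorem isDriving (h : IsMultipleFlow ν x₀ ξ₀ T x ξ) (ht : t ∈ Ico 0 T) : IsDriving ν x t where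
  time_nonneg := ht.1
  integrable := h.integrable t ht
  continuousOn := h.continuousOn_growth.mono fun _ hs => ⟨hs.1, hs.2.trans_lt ht.2⟩

theorem orbit_charge (h : IsMultipleFlow ν x₀ ξ₀ T x ξ) (ht : t ∈ Ico 0 T) (k : Fin m) :
    IsLoewnerOrbit ν x (ξ₀ k) t (fun s => ξ s k) where
  continuousOn := (continuous_apply k).comp_continuousOn
    (h.continuousOn_charges.mono fun _ hs => ⟨hs.1, hs.2.trans_lt ht.2⟩)
  ne_growth s hs j := (h.noCollision s ⟨hs.1, hs.2.trans_lt ht.2⟩).mixed j k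
  eq_integral s hs := h.charges_eq s ⟨hs.1, hs.2.trans_lt ht.2⟩ k

theorem continuousOn_growth_sub_inv (h : IsMultipleFlow ν x₀ ξ₀ T x ξ) (ht : t ∈ Ico 0 T)
    {i j : Fin n} (hij : i ≠ j) :
    ContinuousOn (fun s => ((x s j : ℂ) - x s i)⁻¹) (Icc 0 t) := by
  have hd := h.isDriving ht
  refine ((hd.continuousOn_coord j).sub (hd.continuousOn_coord i)).inv₀ fun s hs => ?_
  have := (h.noCollision s ⟨hs.1, hs.2.trans_lt ht.2⟩).growth.ne hij.symm
  exact sub_ne_zero.mpr (Complex.ofReal_injective.ne this)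

theorem continuousOn_dlogZ (h : IsMultipleFlow ν x₀ ξ₀ T x ξ) (ht : t ∈ Ico 0 T) (j : Fin n) :
    ContinuousOn (fun s => dlogZ (x s) (ξ s) j) (Icc 0 t) := by
  simp only [dlogZ, div_eq_mul_inv]
  refine ContinuousOn.sub (continuousOn_finsetSum _ fun k hk => continuousOn_const.mul
    (h.continuousOn_growth_sub_inv ht (Finset.ne_of_mem_erase hk)))
    (continuousOn_finsetSum _ fun l _ => continuousOn_const.mul ?_)
  have := ((h.orbit_charge ht l).continuousOn_inv (h.isDriving ht) j).neg
  refine this.congr fun s _ => ?_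
  simp only [Pi.neg_apply, ← inv_neg, neg_sub]

theorem intervalIntegrable_growth_sum (h : IsMultipleFlow ν x₀ ξ₀ T x ξ) (ht : t ∈ Ico 0 T)
    (j : Fin n) {c : Fin n → ℝ → ℂ} (hc : ∀ k, ContinuousOn (c k) (Icc 0 t)) :
    IntervalIntegrable (fun s => ∑ k ∈ Finset.univ.erase j,
      2 * (ν s k : ℂ) * (c k s * ((x s j : ℂ) - x s k)⁻¹)) volume 0 t :=
  intervalIntegrable_fun_sum fun k hk => intervalIntegrable_mul_continuousOn ht.1
    ((intervalIntegrable_ofReal (h.integrable t ht k)).const_mul 2)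
    ((hc k).mul (h.continuousOn_growth_sub_inv ht (Finset.ne_of_mem_erase hk)))

theorem intervalIntegrable_growth_velocity (h : IsMultipleFlow ν x₀ ξ₀ T x ξ) (ht : t ∈ Ico 0 T)
    (j : Fin n) :
    IntervalIntegrable (fun s => (ν s j : ℂ) * dlogZ (x s) (ξ s) j
        + ∑ k ∈ Finset.univ.erase j, 2 * (ν s k : ℂ) / ((x s j : ℂ) - (x s k : ℂ))) volume 0 t := by
  have := h.intervalIntegrable_growth_sum ht j (c := fun _ _ => 1) fun _ => continuousOn_const
  have e : ∀ a b : ℂ, 2 * a / b = 2 * a * (1 * b⁻¹) := fun a b => by ring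
  simp only [e]
  exact (intervalIntegrable_mul_continuousOn ht.1 (intervalIntegrable_ofReal (h.integrable t ht j))
    (h.continuousOn_dlogZ ht j)).add this

variable {z : ℂ} {γ : ℝ → ℂ}

theorem intervalIntegrable_growthRate (h : IsMultipleFlow ν x₀ ξ₀ T x ξ) (ht : t ∈ Ico 0 T)
    (hγ : IsLoewnerOrbit ν x z t γ) (j : Fin n) :
    IntervalIntegrable (fun s => growthRate (ν s) (x s) (ξ s) (γ s) j) volume 0 t := by
  have hd := h.isDriving ht
  have hν := intervalIntegrable_ofReal (h.integrable t ht j)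
  exact ((intervalIntegrable_mul_continuousOn ht.1 (hν.const_mul 2)
    ((hγ.continuousOn_inv hd j).pow 2)).sub
    (h.intervalIntegrable_growth_sum ht j fun k => hγ.continuousOn_inv hd k)).sub
    (intervalIntegrable_mul_continuousOn ht.1 hν
      ((h.continuousOn_dlogZ ht j).mul (hγ.continuousOn_inv hd j)))

theorem orbit_sub_growth (h : IsMultipleFlow ν x₀ ξ₀ T x ξ) (ht : t ∈ Ico 0 T)
    (hγ : IsLoewnerOrbit ν x z t γ) (j : Fin n) :
    γ t - x t j = (z - x₀ j) *
      Complex.exp (∫ s in (0 : ℝ)..t, growthRate (ν s) (x s) (ξ s) (γ s) j) := by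
  have hd := h.isDriving ht
  refine eq_mul_exp_of_linear (d := fun s => γ s - x s j) ht.1
    (h.intervalIntegrable_growthRate ht hγ j) (hγ.continuousOn.sub (hd.continuousOn_coord j)) ?_
  intro s hs
  have hs' : s ∈ Ico 0 T := ⟨hs.1, hs.2.trans_lt ht.2⟩
  have e1 := (hγ.mono hs.2).intervalIntegrable_field (hd.mono hs)
  have e2 := h.intervalIntegrable_growth_velocity hs' j
  rw [hγ.eq_integral s hs, h.growth_eq s hs' j, add_sub_add_comm,
    ← intervalIntegral.integral_sub e1 e2]
  congr 1
  refine intervalIntegral.integral_congr fun r hr => ?_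
  rw [uIcc_of_le hs.1] at hr
  have hr' : r ∈ Icc 0 t := ⟨hr.1, hr.2.trans hs.2⟩
  exact loewnerField_sub_growth (h.noCollision r ⟨hr.1, hr'.2.trans_lt ht.2⟩).growth
    (hγ.ne_growth r hr') j

end IsMultipleFlow

/-- The derivative `∏ (w - x j) / ∏ (w - ξ k) ^ 2` of the rational functions under
consideration. -/
noncomputable def density (x : Fin n → ℝ) (ξ : Fin m → ℂ) (w : ℂ) : ℂ :=
  (∏ j, (w - x j)) / (∏ k, (w - ξ k)) ^ 2

namespace IsMultipleFlow

variable {z : ℂ} {γ : ℝ → ℂ}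

/-- The exponential is also the derivative of the inverse flow at `γ t`, so this is the invariance
of the one-form `density dw`. -/
theorem density_eq (h : IsMultipleFlow ν x₀ ξ₀ T x ξ) (ht : t ∈ Ico 0 T)
    (hγ : IsLoewnerOrbit ν x z t γ) :
    density (x t) (ξ t) (γ t) = density x₀ ξ₀ z *
      Complex.exp (∫ s in (0 : ℝ)..t, orbitRate (ν s) (x s) (γ s) (γ s)) := by
  have hd := h.isDriving ht
  have i1 := fun j => h.intervalIntegrable_growthRate ht hγ j
  have i2 := fun k => hγ.intervalIntegrable_orbitRate (h.orbit_charge ht k) hd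
  have e1 : ∏ j, (γ t - x t j) = (∏ j, (z - x₀ j)) *
      Complex.exp (∫ s in (0 : ℝ)..t, ∑ j, growthRate (ν s) (x s) (ξ s) (γ s) j) := by
    rw [intervalIntegral.integral_finsetSum fun j _ => i1 j, Complex.exp_sum,
      ← Finset.prod_mul_distrib]
    exact Finset.prod_congr rfl fun j _ => h.orbit_sub_growth ht hγ j
  have e2 : ∏ k, (γ t - ξ t k) = (∏ k, (z - ξ₀ k)) *
      Complex.exp (-∫ s in (0 : ℝ)..t, ∑ k, orbitRate (ν s) (x s) (γ s) (ξ s k)) := by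
    rw [intervalIntegral.integral_finsetSum fun k _ => i2 k, ← Finset.sum_neg_distrib,
      Complex.exp_sum, ← Finset.prod_mul_distrib]
    refine Finset.prod_congr rfl fun k _ => ?_
    rw [hγ.sub_eq (h.orbit_charge ht k) hd, intervalIntegral.integral_neg]
  have e3 : (∫ s in (0 : ℝ)..t, orbitRate (ν s) (x s) (γ s) (γ s))
      = (∫ s in (0 : ℝ)..t, ∑ j, growthRate (ν s) (x s) (ξ s) (γ s) j)
        + 2 * ∫ s in (0 : ℝ)..t, ∑ k, orbitRate (ν s) (x s) (γ s) (ξ s k) := by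
    have s1 : IntervalIntegrable (fun s => ∑ j, growthRate (ν s) (x s) (ξ s) (γ s) j)
        volume 0 t := intervalIntegrable_fun_sum fun j _ => i1 j
    have s2 : IntervalIntegrable (fun s => ∑ k, orbitRate (ν s) (x s) (γ s) (ξ s k))
        volume 0 t := intervalIntegrable_fun_sum fun k _ => i2 k
    rw [← intervalIntegral.integral_const_mul, ← intervalIntegral.integral_add s1 (s2.const_mul 2)]
    refine intervalIntegral.integral_congr fun s _ => ?_
    exact sum_growthRate_add.symm
  rw [density, density, e1, e2, e3, Complex.exp_add, mul_pow, ← Complex.exp_nat_mul]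
  push_cast
  rw [mul_neg, Complex.exp_neg]
  field_simp

/-- The growth points are real, so the conjugate of a charge orbit is an orbit; it starts at another
charge and coincides with its orbit by uniqueness. -/
theorem conj_closed (h : IsMultipleFlow ν x₀ ξ₀ T x ξ)
    (hconj : ∀ k, ∃ l, ξ₀ l = starRingEnd ℂ (ξ₀ k)) (ht : t ∈ Ico 0 T) (k : Fin m) :
    ∃ l, ξ t l = starRingEnd ℂ (ξ t k) := by
  obtain ⟨l, hl⟩ := hconj k
  have h1 := (h.orbit_charge ht k).conj (h.isDriving ht)
  rw [← hl] at h1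
  exact ⟨l, (h.orbit_charge ht l).unique h1 (h.isDriving ht)⟩

end IsMultipleFlow

/-- As `1 / 0 = 0`, this also holds when `d` vanishes identically; `e2` in `stationary` thus
includes the case `l = k`. -/
theorem one_div_eq_add_integral {a d : ℝ → ℂ} {d₀ : ℂ} (ht : 0 ≤ t)
    (ha : IntervalIntegrable a volume 0 t)
    (hd : ∀ s ∈ Icc 0 t, d s = d₀ * Complex.exp (∫ r in (0 : ℝ)..s, a r)) :
    1 / d t = 1 / d₀ + ∫ s in (0 : ℝ)..t, -a s * (1 / d s) := by
  have key : ∀ s ∈ Icc 0 t, 1 / d s = 1 / d₀ * Complex.exp (∫ r in (0 : ℝ)..s, -a r) := by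
    intro s hs
    rw [hd s hs, intervalIntegral.integral_neg, Complex.exp_neg, one_div, one_div, mul_inv]
  have e : (∫ s in (0 : ℝ)..t, -a s * (1 / d s))
      = ∫ s in (0 : ℝ)..t, 1 / d₀ * (-a s * Complex.exp (∫ r in (0 : ℝ)..s, -a r)) := by
    refine intervalIntegral.integral_congr fun s hs => ?_
    rw [uIcc_of_le ht] at hs
    rw [key s hs]
    ring
  rw [e, intervalIntegral.integral_const_mul, key t ⟨ht, le_rfl⟩,
    exp_integral_eq (a := fun r => -a r) ht ha.neg]
  ring

theorem IsMultipleFlow.stationary (h : IsMultipleFlow ν x₀ ξ₀ T x ξ)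
    (hstat : StationaryRelations x₀ ξ₀) (ht : t ∈ Ico 0 T) : StationaryRelations (x t) (ξ t) := by
  intro k
  have hd := h.isDriving ht
  have hk := h.orbit_charge ht k
  have cont1 : ∀ j, ContinuousOn (fun s => 1 / (ξ s k - x s j)) (Icc 0 t) := fun j => by
    simpa only [one_div] using hk.continuousOn_inv hd j
  have cont2 : ∀ l ∈ Finset.univ.erase k, ContinuousOn (fun s => 1 / (ξ s k - ξ s l)) (Icc 0 t) := by
    intro l hl
    simp only [one_div]
    exact (hk.continuousOn.sub (h.orbit_charge ht l).continuousOn).inv₀ fun s hs => sub_ne_zero.mpr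
      ((h.noCollision s ⟨hs.1, hs.2.trans_lt ht.2⟩).charges.ne (Finset.ne_of_mem_erase hl).symm)
  have i1 := fun j => h.intervalIntegrable_growthRate ht hk j
  have i2 := fun l => hk.intervalIntegrable_orbitRate (h.orbit_charge ht l) hd
  have i3 : ∀ j, IntervalIntegrable (fun s => -growthRate (ν s) (x s) (ξ s) (ξ s k) j *
      (1 / (ξ s k - x s j))) volume 0 t := fun j =>
    intervalIntegrable_mul_continuousOn ht.1 (i1 j).neg (cont1 j)
  have i4 : ∀ l ∈ Finset.univ.erase k, IntervalIntegrable
      (fun s => 2 * (orbitRate (ν s) (x s) (ξ s k) (ξ s l) * (1 / (ξ s k - ξ s l)))) volume 0 t :=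
    fun l hl => (intervalIntegrable_mul_continuousOn ht.1 (i2 l) (cont2 l hl)).const_mul 2
  have hsub : ∀ s ∈ Icc 0 t, uIcc 0 s ⊆ uIcc 0 t := fun s hs =>
    uIcc_subset_uIcc_left (by rwa [uIcc_of_le ht.1])
  have hlin := eq_mul_exp_of_linear (t := t) (d := fun s => -(∑ j, 1 / (ξ s k - x s j))
      + ∑ l ∈ Finset.univ.erase k, 2 / (ξ s k - ξ s l))
    (a := fun s => orbitRate (ν s) (x s) (ξ s k) (ξ s k))
    (d₀ := -(∑ j, 1 / (ξ₀ k - x₀ j)) + ∑ l ∈ Finset.univ.erase k, 2 / (ξ₀ k - ξ₀ l)) ht.1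
    (i2 k) ?_ ?_
  · rw [hstat k, zero_mul] at hlin
    exact hlin
  · refine (continuousOn_finsetSum _ fun j _ => cont1 j).neg.add
      (continuousOn_finsetSum _ fun l hl => ?_)
    refine ((continuousOn_const (c := (2 : ℂ))).mul (cont2 l hl)).congr fun s _ => ?_
    exact (mul_one_div _ _).symm
  · intro s hs
    have hsT : ∀ r ∈ Icc 0 s, r ∈ Ico 0 T := fun r hr => ⟨hr.1, (hr.2.trans hs.2).trans_lt ht.2⟩
    have e1 : ∀ j, 1 / (ξ s k - x s j) = 1 / (ξ₀ k - x₀ j)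
        + ∫ r in (0 : ℝ)..s, -growthRate (ν r) (x r) (ξ r) (ξ r k) j * (1 / (ξ r k - x r j)) :=
      fun j => one_div_eq_add_integral (d := fun r => ξ r k - x r j) hs.1
        ((i1 j).mono_set (hsub s hs))
        fun r hr => h.orbit_sub_growth (hsT r hr) (h.orbit_charge (hsT r hr) k) j
    have e2 : ∀ l, 2 / (ξ s k - ξ s l) = 2 / (ξ₀ k - ξ₀ l)
        + ∫ r in (0 : ℝ)..s,
          2 * (orbitRate (ν r) (x r) (ξ r k) (ξ r l) * (1 / (ξ r k - ξ r l))) := by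
      intro l
      have := one_div_eq_add_integral (d := fun r => ξ r k - ξ r l) hs.1
        ((i2 l).neg.mono_set (hsub s hs))
        fun r hr => (h.orbit_charge (hsT r hr) k).sub_eq (h.orbit_charge (hsT r hr) l)
          (h.isDriving (hsT r hr))
      simp only [neg_neg, Pi.neg_apply] at this
      rw [intervalIntegral.integral_const_mul, ← mul_one_div, this]
      ring
    have e3 : (∫ r in (0 : ℝ)..s, orbitRate (ν r) (x r) (ξ r k) (ξ r k) *
        (-(∑ j, 1 / (ξ r k - x r j)) + ∑ l ∈ Finset.univ.erase k, 2 / (ξ r k - ξ r l)))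
        = -(∑ j, ∫ r in (0 : ℝ)..s,
            -growthRate (ν r) (x r) (ξ r) (ξ r k) j * (1 / (ξ r k - x r j)))
          + ∑ l ∈ Finset.univ.erase k, ∫ r in (0 : ℝ)..s,
            2 * (orbitRate (ν r) (x r) (ξ r k) (ξ r l) * (1 / (ξ r k - ξ r l))) := by
      have i3s := fun j => (i3 j).mono_set (hsub s hs)
      have i4s := fun l hl => (i4 l hl).mono_set (hsub s hs)
      have s1 : IntervalIntegrable (fun r => ∑ j,
          -growthRate (ν r) (x r) (ξ r) (ξ r k) j * (1 / (ξ r k - x r j))) volume 0 s :=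
        intervalIntegrable_fun_sum fun j _ => i3s j
      have s2 : IntervalIntegrable (fun r => ∑ l ∈ Finset.univ.erase k,
          2 * (orbitRate (ν r) (x r) (ξ r k) (ξ r l) * (1 / (ξ r k - ξ r l)))) volume 0 s :=
        intervalIntegrable_fun_sum i4s
      have s3 : IntervalIntegrable (fun r => -∑ j,
          -growthRate (ν r) (x r) (ξ r) (ξ r k) j * (1 / (ξ r k - x r j))) volume 0 s := s1.neg
      rw [← intervalIntegral.integral_finsetSum fun j _ => i3s j,
        ← intervalIntegral.integral_finsetSum i4s, ← intervalIntegral.integral_neg,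
        ← intervalIntegral.integral_add s3 s2]
      refine intervalIntegral.integral_congr fun r hr => ?_
      rw [uIcc_of_le hs.1] at hr
      exact (stationary_rate (h.noCollision r (hsT r hr)) k).symm
    rw [e3, Finset.sum_congr rfl fun j _ => e1 j, Finset.sum_congr rfl fun l _ => e2 l,
      Finset.sum_add_distrib, Finset.sum_add_distrib]
    ring

end

section

/-! ### Rational functions with prescribed critical points and poles -/

open Polynomial

variable {n m : ℕ} {x : Fin n → ℝ} {ξ : Fin m → ℂ}

theorem exists_derivative_eq (B : ℂ[X]) : ∃ A : ℂ[X], derivative A = B := by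
  induction B using Polynomial.induction_on' with
  | add p q hp hq =>
    obtain ⟨a, rfl⟩ := hp
    obtain ⟨b, rfl⟩ := hq
    exact ⟨a + b, derivative_add⟩
  | monomial k b =>
    refine ⟨monomial (k + 1) (b / (k + 1)), ?_⟩
    have : (k : ℂ) + 1 ≠ 0 := by exact_mod_cast Nat.succ_ne_zero k
    rw [derivative_monomial]
    push_cast
    simp [this]

/-- The monic polynomial with roots at the growth points. -/
noncomputable def growthPoly (x : Fin n → ℝ) : ℂ[X] := ∏ j, (X - C (x j : ℂ))

/-- The monic polynomial with roots at the screening charges. -/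
noncomputable def chargePoly (ξ : Fin m → ℂ) : ℂ[X] := ∏ k, (X - C (ξ k))

theorem monic_growthPoly (x : Fin n → ℝ) : (growthPoly x).Monic :=
  monic_prod_of_monic _ _ fun _ _ => monic_X_sub_C _

theorem monic_chargePoly (ξ : Fin m → ℂ) : (chargePoly ξ).Monic :=
  monic_prod_of_monic _ _ fun _ _ => monic_X_sub_C _

theorem natDegree_growthPoly (x : Fin n → ℝ) : (growthPoly x).natDegree = n := by
  simp [growthPoly]

theorem natDegree_chargePoly (ξ : Fin m → ℂ) : (chargePoly ξ).natDegree = m := by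
  simp [chargePoly]

theorem eval_growthPoly (x : Fin n → ℝ) (z : ℂ) : (growthPoly x).eval z = ∏ j, (z - x j) := by
  simp [growthPoly, eval_prod]

theorem eval_chargePoly (ξ : Fin m → ℂ) (z : ℂ) : (chargePoly ξ).eval z = ∏ k, (z - ξ k) := by
  simp [chargePoly, eval_prod]

theorem eval_growthPoly_eq_zero {z : ℂ} : (growthPoly x).eval z = 0 ↔ ∃ j, z = x j := by
  simp [eval_growthPoly, Finset.prod_eq_zero_iff, sub_eq_zero]

theorem eval_chargePoly_eq_zero {z : ℂ} : (chargePoly ξ).eval z = 0 ↔ ∃ k, z = ξ k := by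
  simp [eval_chargePoly, Finset.prod_eq_zero_iff, sub_eq_zero]

theorem map_conj_growthPoly (x : Fin n → ℝ) : (growthPoly x).map (starRingEnd ℂ) = growthPoly x := by
  simp [growthPoly, Polynomial.map_prod]

theorem map_conj_chargePoly (hξ : Function.Injective ξ)
    (hconj : ∀ k, ∃ l, ξ l = starRingEnd ℂ (ξ k)) :
    (chargePoly ξ).map (starRingEnd ℂ) = chargePoly ξ := by
  choose σ hσ using hconj
  have hinj : Function.Injective σ := fun a b h => hξ ((starRingEnd ℂ).injective (by
    rw [← hσ, ← hσ, h]))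
  simp only [chargePoly, Polynomial.map_prod, Polynomial.map_sub, map_X, map_C, ← hσ]
  exact (Finite.injective_iff_bijective.mp hinj).prod_comp fun k => X - C (ξ k)

theorem eval_derivative_prod {ι : Type*} (s : Finset ι) (a : ι → ℂ) {b : ℂ}
    (hb : ∀ i ∈ s, b ≠ a i) :
    (derivative (∏ i ∈ s, (X - C (a i)))).eval b
      = (∏ i ∈ s, (b - a i)) * ∑ i ∈ s, 1 / (b - a i) := by
  classical
  induction s using Finset.induction_on with
  | empty => simp
  | insert i s hi ih =>
    have h1 := ih fun j hj => hb j (Finset.mem_insert_of_mem hj)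
    have h2 := sub_ne_zero.mpr (hb i (Finset.mem_insert_self i s))
    rw [Finset.prod_insert hi, Finset.prod_insert hi, Finset.sum_insert hi, derivative_mul, eval_add,
      eval_mul, eval_mul, h1, eval_prod]
    simp only [derivative_sub, derivative_X, derivative_C, sub_zero, eval_one, eval_sub, eval_X,
      eval_C]
    field_simp

theorem chargePoly_eq_mul (ξ : Fin m → ℂ) (k : Fin m) :
    chargePoly ξ = (X - C (ξ k)) * ∏ l ∈ Finset.univ.erase k, (X - C (ξ l)) :=
  (Finset.mul_prod_erase _ _ (Finset.mem_univ k)).symm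

theorem eval_derivative_chargePoly (ξ : Fin m → ℂ) (k : Fin m) :
    (derivative (chargePoly ξ)).eval (ξ k) = ∏ l ∈ Finset.univ.erase k, (ξ k - ξ l) := by
  rw [chargePoly_eq_mul ξ k, derivative_mul]
  simp [eval_prod]

/-- With `Q = (X - ξ k) E` one has `Q'' (ξ k) = 2 E' (ξ k)`, and `E'` is computed by logarithmic
differentiation. -/
theorem eval_derivative_derivative_chargePoly (hξ : Function.Injective ξ) (k : Fin m) :
    (derivative (derivative (chargePoly ξ))).eval (ξ k)
      = (∏ l ∈ Finset.univ.erase k, (ξ k - ξ l)) *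
        ∑ l ∈ Finset.univ.erase k, 2 / (ξ k - ξ l) := by
  have h := eval_derivative_prod (Finset.univ.erase k) ξ (b := ξ k)
    fun l hl => hξ.ne (Finset.ne_of_mem_erase hl).symm
  have e : ∑ l ∈ Finset.univ.erase k, 2 / (ξ k - ξ l)
      = 2 * ∑ l ∈ Finset.univ.erase k, 1 / (ξ k - ξ l) := by
    rw [Finset.mul_sum]
    exact Finset.sum_congr rfl fun l _ => by ring
  rw [chargePoly_eq_mul ξ k, derivative_mul, derivative_add, derivative_mul, derivative_mul]
  simp only [derivative_sub, derivative_X, derivative_C, sub_zero, derivative_one, zero_mul,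
    one_mul, zero_add, eval_add, eval_mul, eval_sub, eval_X, eval_C, sub_self, add_zero]
  rw [h, e]
  ring

theorem eval_derivative_chargePoly_ne_zero (hξ : Function.Injective ξ) (k : Fin m) :
    (derivative (chargePoly ξ)).eval (ξ k) ≠ 0 := by
  rw [eval_derivative_chargePoly]
  exact Finset.prod_ne_zero_iff.mpr fun l hl =>
    sub_ne_zero.mpr (hξ.ne (Finset.ne_of_mem_erase hl).symm)

theorem sq_dvd_of_eval {D : ℂ[X]} {a : ℂ} (h0 : D.eval a = 0) (h1 : (derivative D).eval a = 0) :
    (X - C a) ^ 2 ∣ D := by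
  obtain ⟨E, rfl⟩ := dvd_iff_isRoot.mpr h0
  rw [derivative_mul] at h1
  simp at h1
  obtain ⟨F, rfl⟩ := dvd_iff_isRoot.mpr h1
  exact ⟨F, by ring⟩

/-- Prescribing `A₀ = -P / Q'` at the charges makes `P - (A₀' Q - A₀ Q')` vanish there. Its
derivative at `ξ k` is `P' - P Q'' / Q'`, which vanishes by the stationary relation. So the defect
is divisible by `Q ^ 2`, and a polynomial primitive corrects it. -/
theorem exists_derivative_quotient (hc : NoCollision x ξ) (hstat : StationaryRelations x ξ) :
    ∃ A : ℂ[X], derivative A * chargePoly ξ - A * derivative (chargePoly ξ) = growthPoly x := by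
  classical
  set P := growthPoly x
  set Q := chargePoly ξ
  have hQ' : ∀ k, (derivative Q).eval (ξ k) ≠ 0 := eval_derivative_chargePoly_ne_zero hc.charges
  have hQ0 : ∀ k, Q.eval (ξ k) = 0 := fun k => eval_chargePoly_eq_zero.mpr ⟨k, rfl⟩
  let A₀ := Lagrange.interpolate Finset.univ ξ fun k => -P.eval (ξ k) / (derivative Q).eval (ξ k)
  have hA₀ : ∀ k, A₀.eval (ξ k) = -P.eval (ξ k) / (derivative Q).eval (ξ k) := fun k =>
    Lagrange.eval_interpolate_at_node _ hc.charges.injOn (Finset.mem_univ k)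
  have hdvd : Q ^ 2 ∣ P - (derivative A₀ * Q - A₀ * derivative Q) := by
    have : Q ^ 2 = ∏ k, (X - C (ξ k)) ^ 2 := (Finset.prod_pow _ _ _).symm
    rw [this]
    refine Finset.prod_dvd_of_coprime (fun k _ l _ hkl => ?_) fun k _ => sq_dvd_of_eval ?_ ?_
    · exact (isCoprime_X_sub_C_of_isUnit_sub (sub_ne_zero.mpr (hc.charges.ne hkl)).isUnit).pow
    · have := hQ' k
      simp only [eval_sub, eval_mul, hQ0, hA₀]
      field_simp
      ring
    · have h1 : (derivative P).eval (ξ k) = P.eval (ξ k) * ∑ j, 1 / (ξ k - x j) := by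
        rw [eval_growthPoly]
        exact eval_derivative_prod _ _ fun j _ => hc.mixed j k
      have h2 : (derivative (derivative Q)).eval (ξ k) = (derivative Q).eval (ξ k) *
          ∑ l ∈ Finset.univ.erase k, 2 / (ξ k - ξ l) := by
        rw [eval_derivative_chargePoly]
        exact eval_derivative_derivative_chargePoly hc.charges k
      have h3 := hstat k
      have h4 := hQ' k
      simp only [derivative_sub, derivative_mul, eval_sub, eval_add, eval_mul, hQ0, hA₀, h1]
      rw [h2]
      field_simp
      linear_combination (-P.eval (ξ k)) * h3
  obtain ⟨B, hB⟩ := hdvd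
  -- Replacing `A₀` by `A₀ + Q D` adds `Q ^ 2 D'` to `A₀' Q - A₀ Q'`.
  obtain ⟨D, hD⟩ := exists_derivative_eq B
  refine ⟨A₀ + Q * D, ?_⟩
  rw [derivative_add, derivative_mul, hD]
  linear_combination -hB

/-- `A` is the numerator of a real rational function with denominator `∏ (X - ξ k)` and derivative
`∏ (X - x j) / ∏ (X - ξ k) ^ 2` which does not take a finite nonzero value at infinity. -/
structure IsNumerator (A : ℂ[X]) (x : Fin n → ℝ) (ξ : Fin m → ℂ) : Prop where
  conj : A.map (starRingEnd ℂ) = A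
  derivative_eq : derivative A * chargePoly ξ - A * derivative (chargePoly ξ) = growthPoly x
  natDegree_ne : A.natDegree ≠ m

theorem derivative_map_conj (A : ℂ[X]) :
    (derivative A).map (starRingEnd ℂ) = derivative (A.map (starRingEnd ℂ)) :=
  (derivative_map A _).symm

theorem exists_isNumerator (hc : NoCollision x ξ) (hconj : ∀ k, ∃ l, ξ l = starRingEnd ℂ (ξ k))
    (hstat : StationaryRelations x ξ) : ∃ A, IsNumerator A x ξ := by
  obtain ⟨A₀, hA₀⟩ := exists_derivative_quotient hc hstat
  set P := growthPoly x
  set Q := chargePoly ξ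
  have hP : P.map (starRingEnd ℂ) = P := map_conj_growthPoly x
  have hP0 : P ≠ 0 := (monic_growthPoly x).ne_zero
  have hQ : Q.map (starRingEnd ℂ) = Q := map_conj_chargePoly hc.charges hconj
  have hA₁ : derivative (A₀.map (starRingEnd ℂ)) * Q - A₀.map (starRingEnd ℂ) * derivative Q = P := by
    have := congrArg (Polynomial.map (starRingEnd ℂ)) hA₀
    rwa [Polynomial.map_sub, Polynomial.map_mul, Polynomial.map_mul, derivative_map_conj,
      derivative_map_conj, hP, hQ] at this
  obtain ⟨A, hAc, hA⟩ : ∃ A : ℂ[X], A.map (starRingEnd ℂ) = A ∧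
      derivative A * Q - A * derivative Q = P := by
    refine ⟨C (1 / 2) * (A₀ + A₀.map (starRingEnd ℂ)), ?_, ?_⟩
    · have : (starRingEnd ℂ).comp (starRingEnd ℂ) = RingHom.id ℂ := by ext; simp
      rw [Polynomial.map_mul, Polynomial.map_add, Polynomial.map_map, this, Polynomial.map_id, map_C,
        add_comm]
      simp [map_ofNat]
    · have h2 : (C (1 / 2) : ℂ[X]) * 2 = 1 := by
        rw [← C_ofNat, ← C_mul]; norm_num
      rw [derivative_C_mul, derivative_add]
      linear_combination C (1 / 2) * hA₀ + C (1 / 2) * hA₁ + P * h2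
  -- If `A / Q` has a finite nonzero value at infinity, this value is real and is subtracted. Degree
  -- `m` cannot recur: the difference would be zero, forcing `growthPoly x = 0`.
  by_cases hdeg : A.natDegree = m
  · refine ⟨A - C A.leadingCoeff * Q, ?_, ?_, fun hm => ?_⟩
    · have : starRingEnd ℂ A.leadingCoeff = A.leadingCoeff := by
        conv_rhs => rw [leadingCoeff, ← hAc, coeff_map, natDegree_map]
        rfl
      rw [Polynomial.map_sub, Polynomial.map_mul, hAc, hQ, map_C, this]
    · rw [derivative_sub, derivative_C_mul]
      linear_combination hA
    · have hQm : Q.coeff m = 1 := by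
        have := monic_chargePoly ξ
        rwa [Monic, leadingCoeff, natDegree_chargePoly] at this
      have : A - C A.leadingCoeff * Q = 0 := by
        rw [← leadingCoeff_eq_zero, leadingCoeff, hm, coeff_sub, coeff_C_mul, hQm, leadingCoeff, hdeg]
        ring
      rw [sub_eq_zero.mp this, derivative_C_mul] at hA
      apply hP0
      rw [← hA]
      ring
  · exact ⟨A, hAc, hA, hdeg⟩

/-- The operator `X * derivative` multiplies the `k`-th coefficient by `k` and avoids the degree
shift of `derivative`. -/
theorem coeff_X_mul_derivative (A : ℂ[X]) (k : ℕ) :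
    (X * derivative A).coeff k = k * A.coeff k := by
  cases k with
  | zero => simp
  | succ k => rw [coeff_X_mul, coeff_derivative]; push_cast; ring

theorem natDegree_X_mul_derivative_le (A : ℂ[X]) : (X * derivative A).natDegree ≤ A.natDegree := by
  rw [natDegree_le_iff_coeff_eq_zero]
  intro k hk
  rw [coeff_X_mul_derivative, coeff_eq_zero_of_natDegree_lt hk, mul_zero]

namespace IsNumerator

variable {A : ℂ[X]}

/-- The top coefficient of `X A' Q - A X Q'` is `(deg A - m)` times that of `A`, nonzero because
`deg A ≠ m`. In particular `n + 1 = 2 m` cannot occur. -/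
theorem natDegree_add (hA : IsNumerator A x ξ) : A.natDegree + m = n + 1 := by
  have hQm : (chargePoly ξ).coeff m = 1 := by
    have := monic_chargePoly ξ
    rwa [Monic, leadingCoeff, natDegree_chargePoly] at this
  have hX : X * growthPoly x = X * derivative A * chargePoly ξ
      - A * (X * derivative (chargePoly ξ)) := by
    rw [← hA.derivative_eq]; ring
  have hdegP : (X * growthPoly x).natDegree = n + 1 := by
    rw [natDegree_X_mul (monic_growthPoly x).ne_zero, natDegree_growthPoly]
  have hXQ : (X * derivative (chargePoly ξ)).natDegree ≤ m := by
    simpa only [natDegree_chargePoly] using natDegree_X_mul_derivative_le (chargePoly ξ)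
  have hA0 : A ≠ 0 := by
    rintro rfl
    have := hA.derivative_eq
    simp only [derivative_zero, zero_mul, sub_zero] at this
    exact (monic_growthPoly x).ne_zero this.symm
  refine le_antisymm ?_ ?_
  · rw [← hdegP]
    refine le_natDegree_of_ne_zero ?_
    rw [hX, coeff_sub, coeff_mul_add_eq_of_natDegree_le (natDegree_X_mul_derivative_le A)
      (natDegree_chargePoly ξ).le, coeff_mul_add_eq_of_natDegree_le le_rfl hXQ, coeff_X_mul_derivative,
      coeff_X_mul_derivative, hQm]
    have h1 : ((A.natDegree : ℂ) - m) * A.leadingCoeff ≠ 0 := by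
      refine mul_ne_zero (sub_ne_zero.mpr ?_) (leadingCoeff_ne_zero.mpr hA0)
      exact_mod_cast hA.natDegree_ne
    convert h1 using 1
    rw [leadingCoeff]
    ring
  · rw [← hdegP, hX]
    refine (natDegree_sub_le _ _).trans (max_le ?_ ?_)
    · refine natDegree_mul_le.trans ?_
      rw [natDegree_chargePoly]
      gcongr
      exact natDegree_X_mul_derivative_le A
    · exact natDegree_mul_le.trans (by gcongr)

theorem eval_ne_zero (hA : IsNumerator A x ξ) (hc : NoCollision x ξ) (k : Fin m) :
    A.eval (ξ k) ≠ 0 := by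
  intro h
  have := congrArg (eval (ξ k)) hA.derivative_eq
  rw [eval_sub, eval_mul, eval_mul, h, eval_chargePoly_eq_zero.mpr ⟨k, rfl⟩, mul_zero, zero_mul,
    sub_zero, eq_comm, eval_growthPoly_eq_zero] at this
  obtain ⟨j, hj⟩ := this
  exact hc.mixed j k hj

theorem isCoprime (hA : IsNumerator A x ξ) (hc : NoCollision x ξ) : IsCoprime A (chargePoly ξ) := by
  refine IsCoprime.prod_right fun k _ => IsCoprime.symm ?_
  rw [(irreducible_X_sub_C (ξ k)).coprime_iff_not_dvd, dvd_iff_isRoot]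
  exact hA.eval_ne_zero hc k

end IsNumerator

/-- The rational function with numerator `A` and denominator `∏ (X - ξ k)`. -/
noncomputable def quotientOf (A : ℂ[X]) (ξ : Fin m → ℂ) : RatFunc ℂ :=
  algebraMap ℂ[X] (RatFunc ℂ) A / algebraMap ℂ[X] (RatFunc ℂ) (chargePoly ξ)

theorem quotientOf_mul (A : ℂ[X]) (ξ : Fin m → ℂ) :
    (quotientOf A ξ).num * chargePoly ξ = A * (quotientOf A ξ).denom :=
  (RatFunc.num_mul_eq_mul_denom_iff (monic_chargePoly ξ).ne_zero).mpr rfl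

theorem quotientOf_denom {A : ℂ[X]} (h : IsCoprime A (chargePoly ξ)) :
    (quotientOf A ξ).denom = chargePoly ξ :=
  eq_of_monic_of_associated (RatFunc.monic_denom _) (monic_chargePoly ξ)
    (associated_of_dvd_dvd (RatFunc.denom_div_dvd _ _)
      (h.symm.dvd_of_dvd_mul_left (Dvd.intro_left _ (quotientOf_mul A ξ))))

theorem quotientOf_num {A : ℂ[X]} (h : IsCoprime A (chargePoly ξ)) :
    (quotientOf A ξ).num = A := by
  have := quotientOf_mul A ξ
  rw [quotientOf_denom h] at this
  exact mul_right_cancel₀ (monic_chargePoly ξ).ne_zero this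

theorem evalFun_quotientOf {A : ℂ[X]} (h : IsCoprime A (chargePoly ξ)) (z : ℂ) :
    evalFun (quotientOf A ξ) z = A.eval z / (chargePoly ξ).eval z := by
  rw [evalFun, quotientOf_num h, quotientOf_denom h]

theorem density_eq_eval (x : Fin n → ℝ) (ξ : Fin m → ℂ) (z : ℂ) :
    density x ξ z = (growthPoly x).eval z / (chargePoly ξ).eval z ^ 2 := by
  rw [density, eval_growthPoly, eval_chargePoly]

theorem conj_eval {A : ℂ[X]} (h : A.map (starRingEnd ℂ) = A) (z : ℂ) :
    starRingEnd ℂ (A.eval (starRingEnd ℂ z)) = A.eval z := by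
  rw [← eval_map_apply, h, Complex.conj_conj]

namespace IsNumerator

variable {A : ℂ[X]}

theorem hasDerivAt (hA : IsNumerator A x ξ) {z : ℂ} (hz : ∀ k, z ≠ ξ k) :
    HasDerivAt (fun w => A.eval w / (chargePoly ξ).eval w) (density x ξ z) z := by
  have hQ : (chargePoly ξ).eval z ≠ 0 := fun h => by
    obtain ⟨k, hk⟩ := eval_chargePoly_eq_zero.mp h
    exact hz k hk
  refine ((A.hasDerivAt z).div ((chargePoly ξ).hasDerivAt z) hQ).congr_deriv ?_
  rw [density_eq_eval, ← hA.derivative_eq, eval_sub, eval_mul, eval_mul]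

theorem conj_quotient (hA : IsNumerator A x ξ) (hξ : Function.Injective ξ)
    (hconj : ∀ k, ∃ l, ξ l = starRingEnd ℂ (ξ k)) (z : ℂ) :
    starRingEnd ℂ (A.eval (starRingEnd ℂ z) / (chargePoly ξ).eval (starRingEnd ℂ z))
      = A.eval z / (chargePoly ξ).eval z := by
  rw [map_div₀, conj_eval hA.conj, conj_eval (map_conj_chargePoly hξ hconj)]

theorem isCriticalPoint_iff (hA : IsNumerator A x ξ) (hc : NoCollision x ξ) (z : ℂ) :
    IsCriticalPoint (quotientOf A ξ) z ↔ ∃ j, z = x j := by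
  have hcop := hA.isCoprime hc
  have hfun : evalFun (quotientOf A ξ) = fun w => A.eval w / (chargePoly ξ).eval w :=
    funext (evalFun_quotientOf hcop)
  rw [IsCriticalPoint, quotientOf_denom hcop, hfun]
  constructor
  · rintro ⟨hQ, hd⟩
    rw [(hA.hasDerivAt fun k hk => hQ (eval_chargePoly_eq_zero.mpr ⟨k, hk⟩)).deriv,
      density_eq_eval, div_eq_zero_iff] at hd
    exact eval_growthPoly_eq_zero.mp (hd.resolve_right (pow_ne_zero 2 hQ))
  · rintro ⟨j, rfl⟩
    refine ⟨fun h => ?_, ?_⟩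
    · obtain ⟨k, hk⟩ := eval_chargePoly_eq_zero.mp h
      exact hc.mixed j k hk.symm
    · rw [(hA.hasDerivAt fun k => (hc.mixed j k).symm).deriv, density_eq_eval,
        eval_growthPoly_eq_zero.mpr ⟨j, rfl⟩, zero_div]

theorem deriv_deriv_ne_zero (hA : IsNumerator A x ξ) (hc : NoCollision x ξ) (j : Fin n) :
    deriv (deriv fun w => A.eval w / (chargePoly ξ).eval w) (x j) ≠ 0 := by
  have hQ : (chargePoly ξ).eval (x j : ℂ) ≠ 0 := fun h => by
    obtain ⟨k, hk⟩ := eval_chargePoly_eq_zero.mp h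
    exact hc.mixed j k hk.symm
  have hev : deriv (fun w => A.eval w / (chargePoly ξ).eval w)
      =ᶠ[𝓝 (x j : ℂ)] fun w => (growthPoly x).eval w / (chargePoly ξ ^ 2).eval w := by
    filter_upwards [(chargePoly ξ).continuous.continuousAt.eventually_ne hQ] with w hw
    rw [(hA.hasDerivAt fun k hk => hw (eval_chargePoly_eq_zero.mpr ⟨k, hk⟩)).deriv,
      density_eq_eval, eval_pow]
  have hQ2 : (chargePoly ξ ^ 2).eval (x j : ℂ) ≠ 0 := by rw [eval_pow]; exact pow_ne_zero 2 hQ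
  -- `growthPoly x` is the `chargePoly` of the points `x j`, so its roots are simple by the same
  -- lemma.
  have hP' : (derivative (growthPoly x)).eval (x j : ℂ) ≠ 0 :=
    eval_derivative_chargePoly_ne_zero (ξ := fun j => (x j : ℂ))
      (Complex.ofReal_injective.comp hc.growth) j
  have hder := (((growthPoly x).hasDerivAt _).div ((chargePoly ξ ^ 2).hasDerivAt _) hQ2).deriv
  rw [hev.deriv_eq]
  refine hder.symm ▸ ?_
  rw [eval_growthPoly_eq_zero.mpr ⟨j, rfl⟩, zero_mul, sub_zero]
  exact div_ne_zero (mul_ne_zero hP' hQ2) (pow_ne_zero 2 hQ2)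

theorem hasSimplePolesAt (hA : IsNumerator A x ξ) (hc : NoCollision x ξ) :
    HasSimplePolesAt (quotientOf A ξ) ξ :=
  ⟨hc.charges, quotientOf_denom (hA.isCoprime hc)⟩

theorem isCR (hA : IsNumerator A x ξ) (hc : NoCollision x ξ)
    (hconj : ∀ k, ∃ l, ξ l = starRingEnd ℂ (ξ k)) : IsCR m x (quotientOf A ξ) where
  distinct := hc.growth
  conj_symm z := by
    rw [evalFun_quotientOf (hA.isCoprime hc), evalFun_quotientOf (hA.isCoprime hc)]
    exact hA.conj_quotient hc.charges hconj z
  critical := hA.isCriticalPoint_iff hc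
  critical_simple j := by
    refine ⟨(hA.isCriticalPoint_iff hc _).mpr ⟨j, rfl⟩, ?_⟩
    have hfun : evalFun (quotientOf A ξ) = fun w => A.eval w / (chargePoly ξ).eval w :=
      funext (evalFun_quotientOf (hA.isCoprime hc))
    rw [hfun]
    exact hA.deriv_deriv_ne_zero hc j
  poles := ⟨ξ, hA.hasSimplePolesAt hc⟩
  order_infinity := by
    rw [quotientOf_num (hA.isCoprime hc), quotientOf_denom (hA.isCoprime hc), natDegree_chargePoly]
    have := hA.natDegree_add
    lia

/-- A real constant may be added if the rational function has a pole at infinity. -/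
theorem add_const (hA : IsNumerator A x ξ) (hξ : Function.Injective ξ)
    (hconj : ∀ k, ∃ l, ξ l = starRingEnd ℂ (ξ k)) {c : ℂ} (hc : starRingEnd ℂ c = c)
    (hdeg : m < A.natDegree) : IsNumerator (A + C c * chargePoly ξ) x ξ where
  conj := by
    rw [Polynomial.map_add, Polynomial.map_mul, hA.conj, map_conj_chargePoly hξ hconj, map_C, hc]
  derivative_eq := by
    rw [derivative_add, derivative_C_mul, ← hA.derivative_eq]
    ring
  natDegree_ne := by
    rw [natDegree_add_eq_left_of_natDegree_lt]
    · exact hA.natDegree_ne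
    · refine (natDegree_C_mul_le _ _).trans_lt ?_
      rwa [natDegree_chargePoly]

/-- The rational function vanishes at infinity if it has no pole there. -/
theorem tendsto_zero {A : ℂ[X]} (hdeg : A.natDegree < m) (ξ : Fin m → ℂ) :
    Tendsto (fun w => A.eval w / (chargePoly ξ).eval w) (Bornology.cobounded ℂ) (𝓝 0) := by
  have hlt : A.degree < (chargePoly ξ).degree := by
    refine degree_lt_degree ?_
    rwa [natDegree_chargePoly]
  exact (isLittleO_cobounded_of_degree_lt hlt).tendsto_div_nhds_zero

end IsNumerator

end

section

/-! ### The inverse flow map -/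

theorem norm_orbitRate_le {n : ℕ} {ν x : Fin n → ℝ} {u v : ℂ} {δ : ℝ} (hδ : 0 < δ)
    (hu : ∀ j, δ ≤ ‖u - x j‖) (hv : ∀ j, δ ≤ ‖v - x j‖) :
    ‖orbitRate ν x u v‖ ≤ ∑ j, 2 * |ν j| * (δ⁻¹ * δ⁻¹) := by
  refine (norm_sum_le _ _).trans (Finset.sum_le_sum fun j _ => ?_)
  rw [norm_mul, norm_mul, norm_mul, Complex.norm_real, Complex.norm_ofNat, Real.norm_eq_abs,
    norm_inv, norm_inv]
  gcongr
  · exact hu j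
  · exact hv j

theorem IsLoewnerOrbit.start_sub_eq {n : ℕ} {ν x : ℝ → Fin n → ℝ} {t : ℝ} {z₁ z₂ : ℂ}
    {γ₁ γ₂ : ℝ → ℂ} (h₁ : IsLoewnerOrbit ν x z₁ t γ₁) (h₂ : IsLoewnerOrbit ν x z₂ t γ₂)
    (hd : IsDriving ν x t) :
    z₁ - z₂ = (γ₁ t - γ₂ t) *
      Complex.exp (∫ s in (0 : ℝ)..t, orbitRate (ν s) (x s) (γ₁ s) (γ₂ s)) := by
  rw [h₁.sub_eq h₂ hd, intervalIntegral.integral_neg, Complex.exp_neg, mul_assoc,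
    inv_mul_cancel₀ (Complex.exp_ne_zero _), mul_one]

theorem IsLoewnerOrbit.eqOn_of_end_eq {n : ℕ} {ν x : ℝ → Fin n → ℝ} {t : ℝ} {z₁ z₂ : ℂ}
    {γ₁ γ₂ : ℝ → ℂ} (h₁ : IsLoewnerOrbit ν x z₁ t γ₁) (h₂ : IsLoewnerOrbit ν x z₂ t γ₂)
    (hd : IsDriving ν x t) (h : γ₁ t = γ₂ t) : EqOn γ₁ γ₂ (Icc 0 t) := by
  intro s hs
  obtain rfl := h₁.start_eq h₂ hd h
  exact (h₁.mono hs.2).unique (h₂.mono hs.2) (hd.mono hs)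

theorem norm_exp_integral_le {a : ℝ → ℂ} {b : ℝ → ℝ} {s t : ℝ} (hs : s ∈ Icc 0 t)
    (hb : IntervalIntegrable b volume 0 t) (hb0 : ∀ r ∈ Icc 0 t, 0 ≤ b r)
    (hab : ∀ r ∈ Icc 0 t, ‖a r‖ ≤ b r) :
    ‖Complex.exp (∫ r in (0 : ℝ)..s, a r)‖ ≤ Real.exp (∫ r in (0 : ℝ)..t, b r) := by
  have ht : 0 ≤ t := hs.1.trans hs.2
  rw [Complex.norm_exp]
  refine Real.exp_le_exp.mpr ((Complex.re_le_norm _).trans ?_)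
  calc _ ≤ ∫ r in (0 : ℝ)..s, b r :=
        intervalIntegral.norm_integral_le_of_norm_le hs.1
          (Eventually.of_forall fun r hr => hab r ⟨hr.1.le, hr.2.trans hs.2⟩)
          (hb.mono_set (uIcc_subset_uIcc_left (by rwa [uIcc_of_le ht])))
    _ ≤ _ := by
        refine intervalIntegral.integral_mono_interval le_rfl hs.1 hs.2 ?_ hb
        filter_upwards [ae_restrict_mem measurableSet_Ioc] with r hr using hb0 r ⟨hr.1.le, hr.2⟩

/-- The starting point of an orbit depends holomorphically on its end point. -/
theorem IsDriving.hasDerivAt_start {n : ℕ} {ν x : ℝ → Fin n → ℝ} {t : ℝ} (hd : IsDriving ν x t)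
    {f : ℂ → ℂ} {Γ : ℂ → ℝ → ℂ} {w : ℂ} {δ : ℝ} (hδ : 0 < δ)
    (hnear : ∀ᶠ w' in 𝓝 w, IsLoewnerOrbit ν x (f w') t (Γ w') ∧ Γ w' t = w' ∧
      ∀ s ∈ Icc 0 t, ∀ j, δ ≤ ‖Γ w' s - x s j‖) :
    HasDerivAt f (Complex.exp (∫ s in (0 : ℝ)..t, orbitRate (ν s) (x s) (Γ w s) (Γ w s))) w := by
  obtain ⟨hw, hwt, hwfar⟩ := hnear.self_of_nhds
  let b : ℝ → ℝ := fun s => ∑ j, 2 * |ν s j| * (δ⁻¹ * δ⁻¹)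
  have hb : IntervalIntegrable b volume 0 t :=
    intervalIntegrable_fun_sum fun j _ => ((hd.integrable j).abs.const_mul 2).mul_const _
  have hb0 : ∀ r ∈ Icc 0 t, 0 ≤ b r := fun r _ => Finset.sum_nonneg fun j _ => by positivity
  set C := Real.exp (∫ r in (0 : ℝ)..t, b r)
  -- One factor `C` goes back from the end points to the starting points, the other forward to time
  -- `s`.
  have hclose : ∀ᶠ w' in 𝓝 w, ∀ s ∈ Icc 0 t, ‖Γ w' s - Γ w s‖ ≤ ‖w' - w‖ * C * C := by
    filter_upwards [hnear] with w' ⟨h1, h2, h3⟩ s hs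
    rw [(h1.mono hs.2).sub_eq (hw.mono hs.2) (hd.mono hs), h1.start_sub_eq hw hd, h2, hwt,
      norm_mul, norm_mul]
    gcongr
    · exact norm_exp_integral_le ⟨hd.time_nonneg, le_rfl⟩ hb hb0 fun r hr =>
        norm_orbitRate_le hδ (h3 r hr) (hwfar r hr)
    · refine norm_exp_integral_le hs hb hb0 fun r hr => ?_
      rw [norm_neg]
      exact norm_orbitRate_le hδ (h3 r hr) (hwfar r hr)
  have hlim : ∀ s ∈ Icc 0 t, Tendsto (fun w' => Γ w' s) (𝓝 w) (𝓝 (Γ w s)) := by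
    intro s hs
    rw [tendsto_iff_norm_sub_tendsto_zero]
    refine squeeze_zero' (Eventually.of_forall fun _ => norm_nonneg _)
      (hclose.mono fun w' h => h s hs) ?_
    have : Continuous fun w' : ℂ => ‖w' - w‖ * C * C := by fun_prop
    simpa using this.tendsto w
  have hI : Tendsto (fun w' => ∫ s in (0 : ℝ)..t, orbitRate (ν s) (x s) (Γ w' s) (Γ w s)) (𝓝 w)
      (𝓝 (∫ s in (0 : ℝ)..t, orbitRate (ν s) (x s) (Γ w s) (Γ w s))) := by
    refine intervalIntegral.tendsto_integral_filter_of_dominated_convergence b ?_ ?_ hb ?_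
    · filter_upwards [hnear] with w' h
      have := (h.1.intervalIntegrable_orbitRate hw hd).1.aestronglyMeasurable
      rwa [uIoc_of_le hd.time_nonneg]
    · filter_upwards [hnear] with w' h
      refine Eventually.of_forall fun s hs => ?_
      rw [uIoc_of_le hd.time_nonneg] at hs
      have hs' : s ∈ Icc 0 t := ⟨hs.1.le, hs.2⟩
      exact norm_orbitRate_le hδ (h.2.2 s hs') (hwfar s hs')
    · refine Eventually.of_forall fun s hs => ?_
      rw [uIoc_of_le hd.time_nonneg] at hs
      have hs' : s ∈ Icc 0 t := ⟨hs.1.le, hs.2⟩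
      refine tendsto_finsetSum _ fun j _ => Tendsto.const_mul _ (Tendsto.mul_const _ ?_)
      exact ((hlim s hs').sub_const _).inv₀ (sub_ne_zero.mpr (hw.ne_growth s hs' j))
  -- The difference quotient is exactly the exponential of the integrated `orbitRate` of the two
  -- orbits, so only the convergence `hI` is needed.
  rw [hasDerivAt_iff_tendsto_slope]
  refine (((Complex.continuous_exp.tendsto _).comp hI).mono_left nhdsWithin_le_nhds).congr' ?_
  filter_upwards [nhdsWithin_le_nhds hnear, self_mem_nhdsWithin] with w' h hne
  have hne' : w' - w ≠ 0 := sub_ne_zero.mpr hne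
  rw [slope_def_field, h.1.start_sub_eq hw hd, h.2.1, hwt, Function.comp_apply]
  field_simp

/-- The upper half-plane together with a half-plane to the right. -/
def rightExtendedHalf (L : ℝ) : Set ℂ := {w | 0 < w.im} ∪ {w | L < w.re}

theorem isOpen_rightExtendedHalf (L : ℝ) : IsOpen (rightExtendedHalf L) :=
  (isOpen_lt continuous_const Complex.continuous_im).union
    (isOpen_lt continuous_const Complex.continuous_re)

theorem isPreconnected_rightExtendedHalf (L : ℝ) : IsPreconnected (rightExtendedHalf L) := by
  refine IsPreconnected.union (⟨L + 1, 1⟩ : ℂ) ?_ ?_ (convex_halfSpace_im_gt 0).isPreconnected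
    (convex_halfSpace_re_gt L).isPreconnected
  · simp
  · simp

theorem IsDriving.exists_bound {n : ℕ} {ν x : ℝ → Fin n → ℝ} {t : ℝ} (hd : IsDriving ν x t) :
    ∃ M, 0 ≤ M ∧ ∀ s ∈ Icc 0 t, ∀ j, |x s j| ≤ M := by
  obtain ⟨M, hM⟩ := isCompact_Icc.exists_bound_of_continuousOn hd.continuousOn
  exact ⟨M, (norm_nonneg _).trans (hM 0 ⟨le_rfl, hd.time_nonneg⟩), fun s hs j =>
    (norm_le_pi_norm (x s) j).trans (hM s hs)⟩

/-- The inverse flow map, extended to a half-plane to the right. -/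
theorem IsDriving.exists_inverse_flow {n : ℕ} {ν x : ℝ → Fin n → ℝ} {t : ℝ} (hd : IsDriving ν x t)
    (hν : ∀ s ∈ Icc 0 t, ∀ j, 0 ≤ ν s j) (L₀ : ℝ) :
    ∃ L Λ : ℝ, ∃ (f : ℂ → ℂ) (Γ : ℂ → ℝ → ℂ), L₀ ≤ L ∧
      (∀ w ∈ rightExtendedHalf L, IsLoewnerOrbit ν x (f w) t (Γ w) ∧ Γ w t = w ∧ HasDerivAt f
        (Complex.exp (∫ s in (0 : ℝ)..t, orbitRate (ν s) (x s) (Γ w s) (Γ w s))) w) ∧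
      ∀ w : ℂ, L < w.re → ‖f w - w‖ ≤ Λ ∧ (w.im = 0 → (f w).im = 0) := by
  obtain ⟨M₁, -, hM₁⟩ := hd.exists_bound
  obtain ⟨Λ, hΛ, hback⟩ := hd.exists_backward_of_re
  set M := max M₁ L₀
  have hM : ∀ s ∈ Icc 0 t, ∀ j, x s j ≤ M := fun s hs j =>
    ((le_abs_self _).trans (hM₁ s hs j)).trans (le_max_left _ _)
  set L := M + 1 + Λ
  have hex : ∀ w ∈ rightExtendedHalf L, ∃ p : ℂ × (ℝ → ℂ),
      IsLoewnerOrbit ν x p.1 t p.2 ∧ p.2 t = w := by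
    rintro w (hw | hw)
    · obtain ⟨γ, z, h1, h2, -⟩ := hd.exists_backward_of_im hν hw le_rfl
      exact ⟨(z, γ), h1, h2⟩
    · obtain ⟨γ, z, h1, h2, -⟩ := hback M hM w (le_of_lt hw)
      exact ⟨(z, γ), h1, h2⟩
  choose! p hp using hex
  refine ⟨L, Λ, fun w => (p w).1, fun w => (p w).2, ?_, fun w hw => ?_, fun w hw => ?_⟩
  · linarith [le_max_right M₁ L₀]
  · refine ⟨(hp w hw).1, (hp w hw).2, ?_⟩
    have hU : ∀ᶠ w' in 𝓝 w, w' ∈ rightExtendedHalf L := (isOpen_rightExtendedHalf L).mem_nhds hw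
    rcases hw with hw | hw
    · have hw0 : 0 < w.im := hw
      refine hd.hasDerivAt_start (f := fun w => (p w).1) (Γ := fun w => (p w).2) (half_pos hw0) ?_
      filter_upwards [hU, Complex.continuous_im.continuousAt.eventually_const_lt
        (half_lt_self hw0)] with w' hw' him
      -- By uniqueness the chosen orbit is this backward orbit, which supplies a distance bound
      -- uniform for `w'` near `w`.
      obtain ⟨γ, z, h1, h2, -, h3⟩ := hd.exists_backward_of_im hν (half_pos hw0) him.le
      refine ⟨(hp w' hw').1, (hp w' hw').2, fun s hs j => ?_⟩
      rw [(hp w' hw').1.eqOn_of_end_eq h1 hd ((hp w' hw').2.trans h2.symm) hs]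
      exact h3 s hs j
    · refine hd.hasDerivAt_start (f := fun w => (p w).1) (Γ := fun w => (p w).2) one_pos ?_
      filter_upwards [hU, Complex.continuous_re.continuousAt.eventually_const_lt hw] with w' hw' hre
      obtain ⟨γ, z, h1, h2, h3, -⟩ := hback M hM w' hre.le
      refine ⟨(hp w' hw').1, (hp w' hw').2, fun s hs j => ?_⟩
      rw [(hp w' hw').1.eqOn_of_end_eq h1 hd ((hp w' hw').2.trans h2.symm) hs]
      exact h3 s hs j
  · have hw' : w ∈ rightExtendedHalf L := Or.inr hw
    obtain ⟨γ, z, h1, h2, -, h3, h4⟩ := hback M hM w (le_of_lt hw)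
    have : (p w).1 = z := (hp w hw').1.start_eq h1 hd ((hp w hw').2.trans h2.symm)
    simp only [this]
    exact ⟨h3, h4⟩

/-! ### Conservation of the rational function -/

open Polynomial

variable {n m : ℕ} {ν x : ℝ → Fin n → ℝ} {ξ : ℝ → Fin m → ℂ} {x₀ : Fin n → ℝ} {ξ₀ : Fin m → ℂ}
  {t T : ℝ}

theorem IsMultipleFlow.end_eq_charge_iff (h : IsMultipleFlow ν x₀ ξ₀ T x ξ) (ht : t ∈ Ico 0 T)
    {z : ℂ} {γ : ℝ → ℂ} (hγ : IsLoewnerOrbit ν x z t γ) (k : Fin m) :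
    γ t = ξ t k ↔ z = ξ₀ k := by
  have hk := h.orbit_charge ht k
  constructor
  · exact fun e => hγ.start_eq hk (h.isDriving ht) e
  · rintro rfl
    exact hγ.unique hk (h.isDriving ht)

/-- The constant between the two primitives is found on `L < re w`: this half-plane is convex, free
of poles, and contains a real ray reaching infinity. The conclusion is cross-multiplied so that it
is analytic, and meaningful, at the poles as well. -/
theorem IsMultipleFlow.exists_numerator (h : IsMultipleFlow ν x₀ ξ₀ T x ξ)
    (hc : NoCollision x₀ ξ₀) (hconj : ∀ k, ∃ l, ξ₀ l = starRingEnd ℂ (ξ₀ k))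
    (hstat : StationaryRelations x₀ ξ₀) {A₀ : ℂ[X]} (hA₀ : IsNumerator A₀ x₀ ξ₀)
    (ht : t ∈ Ico 0 T) :
    ∃ A, IsNumerator A (x t) (ξ t) ∧ ∀ z γ, 0 < z.im → IsLoewnerOrbit ν x z t γ →
      A₀.eval z * (chargePoly (ξ t)).eval (γ t)
        = A.eval (γ t) * (chargePoly ξ₀).eval z := by
  have hd := h.isDriving ht
  have hct := h.noCollision t ht
  have hconjt := h.conj_closed hconj ht
  obtain ⟨A₁, hA₁⟩ := exists_isNumerator hct hconjt (h.stationary hstat ht)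
  obtain ⟨L, Λ, f, Γ, hL, hf, hright⟩ := hd.exists_inverse_flow
    (fun s hs j => h.nonneg s hs.1 j) ‖ξ t‖
  have hH : ∀ w : ℂ, L < w.re → w ∈ rightExtendedHalf L := fun w hw => Or.inr hw
  have hne : ∀ w : ℂ, L < w.re → ∀ k, w ≠ ξ t k := by
    rintro w hw k rfl
    have := (Complex.re_le_norm _).trans (norm_le_pi_norm (ξ t) k)
    linarith
  have hne₀ : ∀ w : ℂ, L < w.re → ∀ k, f w ≠ ξ₀ k := by
    intro w hw k e
    obtain ⟨h1, h2, -⟩ := hf w (hH w hw)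
    exact hne w hw k (h2.symm.trans ((h.end_eq_charge_iff ht h1 k).mpr e))
  have hderiv : ∀ w : ℂ, L < w.re → HasDerivAt (fun w => A₀.eval (f w) / (chargePoly ξ₀).eval (f w)
      - A₁.eval w / (chargePoly (ξ t)).eval w) 0 w := by
    intro w hw
    obtain ⟨h1, h2, h3⟩ := hf w (hH w hw)
    have e1 := (hA₀.hasDerivAt (hne₀ w hw)).comp w h3
    refine (e1.sub (hA₁.hasDerivAt (hne w hw))).congr_deriv ?_
    have := h.density_eq ht h1
    rw [h2] at this
    rw [this, sub_self]
  have hopen : IsOpen {w : ℂ | L < w.re} := isOpen_lt continuous_const Complex.continuous_re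
  obtain ⟨c, hcst⟩ := hopen.exists_is_const_of_deriv_eq_zero
    (convex_halfSpace_re_gt L).isPreconnected
    (fun w hw => (hderiv w hw).differentiableAt.differentiableWithinAt)
    (fun w hw => (hderiv w hw).deriv)
  have hreal : ∀ r : ℝ, L < r → starRingEnd ℂ (f r) = f r := fun r hr =>
    Complex.conj_eq_iff_im.mpr ((hright r (by simpa using hr)).2 (by simp))
  -- The inverse flow maps the real ray to real points, where both rational functions are real.
  have hcreal : starRingEnd ℂ c = c := by
    have hr : L < L + 1 := lt_add_one L
    have e0 := hcst ((L + 1 : ℝ) : ℂ) (by simp)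
    have e1 := hA₀.conj_quotient hc.charges hconj (f ((L + 1 : ℝ) : ℂ))
    have e2 := hA₁.conj_quotient hct.charges hconjt ((L + 1 : ℝ) : ℂ)
    rw [hreal _ hr] at e1
    rw [Complex.conj_ofReal] at e2
    rw [← e0, map_sub, e1, e2]
  obtain ⟨A, hA, hAeq⟩ : ∃ A, IsNumerator A (x t) (ξ t) ∧ ∀ w : ℂ, L < w.re →
      A₀.eval (f w) / (chargePoly ξ₀).eval (f w) = A.eval w / (chargePoly (ξ t)).eval w := by
    have hQ : ∀ w : ℂ, L < w.re → (chargePoly (ξ t)).eval w ≠ 0 := fun w hw e => by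
      obtain ⟨k, hk⟩ := eval_chargePoly_eq_zero.mp e
      exact hne w hw k hk
    -- Both numerators have degree `n + 1 - m`. Below `m`, both functions vanish at infinity and `f`
    -- moves points by at most `Λ`, so `c = 0`; above `m`, adding `c` to the new function keeps it
    -- admissible.
    rcases lt_or_gt_of_ne hA₁.natDegree_ne with hlt | hgt
    · have hlt₀ : A₀.natDegree < m := by
        have := hA₀.natDegree_add
        have := hA₁.natDegree_add
        lia
      have hr : Tendsto (fun r : ℝ => (r : ℂ)) atTop (Bornology.cobounded ℂ) := by
        rw [← tendsto_norm_atTop_iff_cobounded]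
        simpa using tendsto_abs_atTop_atTop
      have hfr : Tendsto (fun r : ℝ => f r) atTop (Bornology.cobounded ℂ) := by
        rw [← tendsto_norm_atTop_iff_cobounded]
        refine tendsto_atTop_mono' _ ?_ (tendsto_atTop_add_const_right _ (-Λ) tendsto_id)
        filter_upwards [eventually_gt_atTop L] with r hr
        have e1 := (hright r (by simpa using hr)).1
        have e2 := norm_sub_norm_le (r : ℂ) (f r)
        rw [norm_sub_rev] at e2
        have e3 := (le_abs_self r).trans_eq (Complex.norm_real r).symm
        simp only [id]
        linarith
      have hlim := ((IsNumerator.tendsto_zero hlt₀ ξ₀).comp hfr).sub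
        ((IsNumerator.tendsto_zero hlt (ξ t)).comp hr)
      have hc0 : c = 0 := by
        rw [sub_zero] at hlim
        refine tendsto_nhds_unique (tendsto_const_nhds.congr' ?_) hlim
        filter_upwards [eventually_gt_atTop L] with r hr
        exact (hcst r (by simpa using hr)).symm
      refine ⟨A₁, hA₁, fun w hw => ?_⟩
      have := hcst w hw
      rwa [hc0, sub_eq_zero] at this
    · refine ⟨_, hA₁.add_const hct.charges hconjt hcreal hgt, fun w hw => ?_⟩
      have := hcst w hw
      have hQw := hQ w hw
      rw [eval_add, eval_mul, eval_C, add_div, mul_div_cancel_right₀ _ hQw, ← this]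
      ring
  refine ⟨A, hA, ?_⟩
  have hQ : ∀ w : ℂ, L < w.re → (chargePoly (ξ t)).eval w ≠ 0 := fun w hw e => by
    obtain ⟨k, hk⟩ := eval_chargePoly_eq_zero.mp e
    exact hne w hw k hk
  have hQ₀ : ∀ w : ℂ, L < w.re → (chargePoly ξ₀).eval (f w) ≠ 0 := fun w hw e => by
    obtain ⟨k, hk⟩ := eval_chargePoly_eq_zero.mp e
    exact hne₀ w hw k hk
  have hfd : DifferentiableOn ℂ f (rightExtendedHalf L) := fun w hw =>
    (hf w hw).2.2.differentiableAt.differentiableWithinAt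
  have hpoly : ∀ p : ℂ[X], DifferentiableOn ℂ (fun w => p.eval (f w)) (rightExtendedHalf L) :=
    fun p => p.differentiable.comp_differentiableOn hfd
  have hEq : EqOn (fun w => A₀.eval (f w) * (chargePoly (ξ t)).eval w)
      (fun w => A.eval w * (chargePoly ξ₀).eval (f w)) (rightExtendedHalf L) := by
    refine AnalyticOnNhd.eqOn_of_preconnected_of_eventuallyEq (z₀ := ((L + 1 : ℝ) : ℂ))
      (((hpoly A₀).mul (Polynomial.differentiable _).differentiableOn).analyticOnNhd
        (isOpen_rightExtendedHalf L))
      (((Polynomial.differentiable _).differentiableOn.mul (hpoly _)).analyticOnNhd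
        (isOpen_rightExtendedHalf L))
      (isPreconnected_rightExtendedHalf L) (hH _ (by simp)) ?_
    filter_upwards [hopen.mem_nhds (show L < (((L + 1 : ℝ) : ℂ)).re by simp)] with w hw
    exact (div_eq_div_iff (hQ₀ w hw) (hQ w hw)).mp (hAeq w hw)
  intro z γ hz hγ
  have hw : γ t ∈ rightExtendedHalf L := Or.inl (hγ.im_pos hd hz)
  obtain ⟨h1, h2, -⟩ := hf _ hw
  have hz' : f (γ t) = z := h1.start_eq hγ hd h2
  have := hEq hw
  simpa only [hz'] using this

/-! ### The hull -/

theorem norm_density_le {x : Fin n → ℝ} {ξ : Fin m → ℂ} {u : ℂ} {B r : ℝ} (hr : 0 < r)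
    (hx : ∀ j, ‖u - x j‖ ≤ B) (hξ : ∀ k, r ≤ ‖u - ξ k‖) :
    ‖density x ξ u‖ ≤ B ^ n / (r ^ m) ^ 2 := by
  rw [density, norm_div, norm_pow, norm_prod, norm_prod]
  have h1 : ∏ j, ‖u - x j‖ ≤ B ^ n := by
    simpa using Finset.prod_le_prod (s := Finset.univ) (fun j _ => norm_nonneg (u - x j))
      fun j _ => hx j
  have h2 : r ^ m ≤ ∏ k, ‖u - ξ k‖ := by
    simpa using Finset.prod_le_prod (s := Finset.univ) (fun _ _ => hr.le) fun k _ => hξ k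
  gcongr
  exact (Finset.prod_nonneg fun j _ => norm_nonneg _).trans h1

/-- Near the growth points the rational function is almost real. -/
theorem IsNumerator.abs_im_le {x : Fin n → ℝ} {ξ : Fin m → ℂ} {A : ℂ[X]} (hA : IsNumerator A x ξ)
    (hc : NoCollision x ξ) (hconj : ∀ k, ∃ l, ξ l = starRingEnd ℂ (ξ k)) {j : Fin n} {r B : ℝ}
    (hr : 0 < r) (hx : ∀ i, ‖(x j : ℂ) - x i‖ ≤ B) (hξ : ∀ k, 2 * r ≤ ‖ξ k - x j‖) {u : ℂ}
    (hu : ‖u - x j‖ ≤ r) :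
    |(A.eval u / (chargePoly ξ).eval u).im| ≤ (r + B) ^ n / (r ^ m) ^ 2 * ‖u - x j‖ := by
  have hfar : ∀ v ∈ Metric.closedBall (x j : ℂ) r, ∀ k, r ≤ ‖v - ξ k‖ := by
    intro v hv k
    rw [mem_closedBall_iff_norm] at hv
    have e1 := norm_sub_norm_le (ξ k - x j) (v - x j)
    rw [sub_sub_sub_cancel_right] at e1
    linarith [hξ k, norm_sub_rev (ξ k) v]
  -- Mean value inequality on the ball around `x j`, whose points have distance at most `r + B` from
  -- the growth points and at least `r` from the charges. The value at `x j` is real.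
  have hmv := (convex_closedBall (x j : ℂ) r).norm_image_sub_le_of_norm_hasDerivWithin_le
    (f := fun w => A.eval w / (chargePoly ξ).eval w) (f' := density x ξ)
    (C := (r + B) ^ n / (r ^ m) ^ 2) (x := (x j : ℂ)) (y := u)
    (fun v hv => (hA.hasDerivAt fun k hk => by
      have := hfar v hv k
      rw [hk, sub_self, norm_zero] at this
      linarith).hasDerivWithinAt)
    (fun v hv => norm_density_le hr (fun i => by
      have e := norm_add_le (v - x j) ((x j : ℂ) - x i)
      rw [sub_add_sub_cancel] at e
      rw [mem_closedBall_iff_norm] at hv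
      linarith [hx i]) (hfar v hv))
    (Metric.mem_closedBall_self hr.le) (by rwa [mem_closedBall_iff_norm])
  have hreal : (A.eval (x j : ℂ) / (chargePoly ξ).eval (x j : ℂ)).im = 0 := by
    rw [← Complex.conj_eq_iff_im]
    simpa only [Complex.conj_ofReal] using hA.conj_quotient hc.charges hconj (x j : ℂ)
  refine le_trans ?_ hmv
  refine le_trans (le_of_eq ?_) (Complex.abs_im_le_norm _)
  rw [Complex.sub_im, hreal, sub_zero]

theorem mem_realLocus_quotientOf {ξ : Fin m → ℂ} {A : ℂ[X]} (h : IsCoprime A (chargePoly ξ)) {z : ℂ}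
    (hz : (chargePoly ξ).eval z ≠ 0 → (A.eval z / (chargePoly ξ).eval z).im = 0) :
    z ∈ realLocus (quotientOf A ξ) := by
  by_cases hQ : (chargePoly ξ).eval z = 0
  · left
    rw [evalSphere, quotientOf_denom h, if_pos hQ]
  · right
    refine ⟨(A.eval z / (chargePoly ξ).eval z).re, ?_⟩
    rw [evalSphere, quotientOf_denom h, if_neg hQ, evalFun_quotientOf h]
    congr 1
    exact Complex.ext (by simp) (by simpa using hz hQ)

theorem IsMultipleFlow.hull_subset (h : IsMultipleFlow ν x₀ ξ₀ T x ξ)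
    (hc : NoCollision x₀ ξ₀) (hconj : ∀ k, ∃ l, ξ₀ l = starRingEnd ℂ (ξ₀ k))
    (hstat : StationaryRelations x₀ ξ₀) {A₀ : ℂ[X]} (hA₀ : IsNumerator A₀ x₀ ξ₀)
    (ht : t ∈ Ico 0 T) : hull ν x t ⊆ realLocus (quotientOf A₀ ξ₀) := by
  have hd := h.isDriving ht
  intro z hz
  refine mem_realLocus_quotientOf (hA₀.isCoprime hc) fun hQ => ?_
  rcases hz.1.eq_or_lt with h0 | hpos
  · have e := hA₀.conj_quotient hc.charges hconj z
    rw [Complex.conj_eq_iff_im.mpr h0.symm] at e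
    exact Complex.conj_eq_iff_im.mp e
  have hno : ¬ ∃ γ, IsLoewnerOrbit ν x z t γ := by
    intro hex
    obtain ⟨t', htt', ht'T⟩ := exists_between ht.2
    exact ((mem_upperHalf_diff_hull (h.isDriving ⟨ht.1.trans htt'.le, ht'T⟩) ht.1 htt').mpr
      ⟨hpos, hex⟩).2 hz
  have hz0 : ∀ j, z ≠ x 0 j := by
    rintro j rfl
    simp at hpos
  obtain ⟨B, hB0, hB⟩ := hd.exists_bound
  have hsep : ∀ k, ∃ δ > 0, ∀ j, ∀ s ∈ Icc 0 t, δ ≤ ‖ξ s k - x s j‖ := fun k =>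
    (h.orbit_charge ht k).exists_dist_le hd
  choose δ hδ0 hδ using hsep
  obtain ⟨ρ, hρ, hρle⟩ := exists_pos_forall_le hδ0
  set r := ρ / 2
  have hr : 0 < r := half_pos hρ
  set K := (r + 2 * B) ^ n / (r ^ m) ^ 2
  have hK : 0 ≤ K := by positivity
  -- The constant `K` does not depend on the time `s` of the near approach: the growth points are
  -- bounded and the charges keep distance `ρ = 2 r` from them on all of `[0, t]`.
  have key : ∀ ε > 0, |(A₀.eval z / (chargePoly ξ₀).eval z).im| ≤ K * ε := by
    intro ε hε
    obtain ⟨s, hs, γ, hγ, j, hj⟩ := hd.exists_near_of_not_exists_orbit hz0 hno (lt_min hr hε)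
    have hsT : s ∈ Ico 0 T := ⟨hs.1, hs.2.trans_lt ht.2⟩
    obtain ⟨A, hA, hAeq⟩ := h.exists_numerator hc hconj hstat hA₀ hsT
    have hQs : (chargePoly (ξ s)).eval (γ s) ≠ 0 := fun e => by
      obtain ⟨k, hk⟩ := eval_chargePoly_eq_zero.mp e
      exact hQ (eval_chargePoly_eq_zero.mpr ⟨k, (h.end_eq_charge_iff hsT hγ k).mp hk⟩)
    rw [(div_eq_div_iff hQ hQs).mpr (hAeq z γ hpos hγ)]
    refine (hA.abs_im_le (B := 2 * B) (h.noCollision s hsT) (h.conj_closed hconj hsT) hr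
      (fun i => ?_) (fun k => ?_) (hj.trans (min_le_left _ _))).trans ?_
    · rw [← Complex.ofReal_sub, Complex.norm_real, Real.norm_eq_abs]
      have := abs_sub (x s j) (x s i)
      linarith [hB s hs j, hB s hs i]
    · calc 2 * r = ρ := by simp only [r]; ring
        _ ≤ δ k := hρle k
        _ ≤ _ := hδ k j s hs
    · gcongr
      exact hj.trans (min_le_right _ _)
  by_contra hne
  have hpos' : 0 < |(A₀.eval z / (chargePoly ξ₀).eval z).im| := abs_pos.mpr hne
  have := key (|(A₀.eval z / (chargePoly ξ₀).eval z).im| / (2 * (K + 1))) (by positivity)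
  rw [← mul_div_assoc, le_div_iff₀ (by positivity)] at this
  nlinarith

/-! ### Bijectivity of the flow map and the transported rational function -/

theorem IsMultipleFlow.bijOn_flowMap (h : IsMultipleFlow ν x₀ ξ₀ T x ξ) (ht : t ∈ Ico 0 T) :
    BijOn (flowMap ν x t) (upperHalf \ hull ν x t) upperHalf := by
  have hd := h.isDriving ht
  obtain ⟨t', htt', ht'T⟩ := exists_between ht.2
  have hmem := fun z => mem_upperHalf_diff_hull (z := z)
    (h.isDriving ⟨ht.1.trans htt'.le, ht'T⟩) ht.1 htt'
  refine ⟨fun z hz => ?_, fun z₁ hz₁ z₂ hz₂ e => ?_, fun w hw => ?_⟩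
  · obtain ⟨hpos, γ, hγ⟩ := (hmem z).mp hz
    rw [flowMap_eq hd hγ]
    exact hγ.im_pos hd hpos
  · obtain ⟨-, γ₁, h₁⟩ := (hmem z₁).mp hz₁
    obtain ⟨-, γ₂, h₂⟩ := (hmem z₂).mp hz₂
    rw [flowMap_eq hd h₁, flowMap_eq hd h₂] at e
    exact h₁.start_eq h₂ hd e
  · obtain ⟨γ, z, h1, h2, h3, -⟩ := hd.exists_backward_of_im
      (fun s hs j => h.nonneg s hs.1 j) hw le_rfl
    exact ⟨z, (hmem z).mpr ⟨h3, γ, h1⟩, (flowMap_eq hd h1).trans h2⟩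

theorem IsMultipleFlow.eqOn_evalSphere (h : IsMultipleFlow ν x₀ ξ₀ T x ξ)
    (hc : NoCollision x₀ ξ₀) {A₀ A : ℂ[X]} (hA₀ : IsNumerator A₀ x₀ ξ₀)
    (ht : t ∈ Ico 0 T) (hA : IsNumerator A (x t) (ξ t))
    (hAeq : ∀ z γ, 0 < z.im → IsLoewnerOrbit ν x z t γ →
      A₀.eval z * (chargePoly (ξ t)).eval (γ t) = A.eval (γ t) * (chargePoly ξ₀).eval z) :
    EqOn (evalSphere (quotientOf A₀ ξ₀) ∘ flowMapInv ν x t) (evalSphere (quotientOf A (ξ t)))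
      upperHalf := by
  intro w hw
  have hd := h.isDriving ht
  have hbij := h.bijOn_flowMap ht
  have hsurj := hbij.surjOn hw
  have hzmem : flowMapInv ν x t w ∈ upperHalf \ hull ν x t := Function.invFunOn_mem hsurj
  have hzw : flowMap ν x t (flowMapInv ν x t w) = w := Function.invFunOn_eq hsurj
  set z := flowMapInv ν x t w
  obtain ⟨t', htt', ht'T⟩ := exists_between ht.2
  obtain ⟨hpos, γ, hγ⟩ := (mem_upperHalf_diff_hull
    (h.isDriving ⟨ht.1.trans htt'.le, ht'T⟩) ht.1 htt').mp hzmem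
  have hγw : γ t = w := (flowMap_eq hd hγ).symm.trans hzw
  have hcop₀ := hA₀.isCoprime hc
  have hcop := hA.isCoprime (h.noCollision t ht)
  -- Poles correspond to poles, so both sides take the value `∞` together.
  have hzero : (chargePoly ξ₀).eval z = 0 ↔ (chargePoly (ξ t)).eval w = 0 := by
    rw [eval_chargePoly_eq_zero, eval_chargePoly_eq_zero, ← hγw]
    exact exists_congr fun k => (h.end_eq_charge_iff ht hγ k).symm
  change evalSphere _ z = _
  rw [evalSphere, evalSphere, quotientOf_denom hcop₀, quotientOf_denom hcop,
    evalFun_quotientOf hcop₀, evalFun_quotientOf hcop]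
  by_cases hQ : (chargePoly ξ₀).eval z = 0
  · rw [if_pos hQ, if_pos (hzero.mp hQ)]
  · have hQ' := fun e => hQ (hzero.mpr e)
    have e := hAeq z γ hpos hγ
    rw [hγw] at e
    rw [if_neg hQ, if_neg hQ', (div_eq_div_iff hQ hQ').mpr e]

end

end ChordalSLE

theorem mainTheorem1 {n m : ℕ} (x : Fin n → ℝ) (ξ : Fin m → ℂ)
    (hdistinct : ChordalSLE.NoCollision x ξ)
    (hconj : ∀ k, ∃ l, ξ l = starRingEnd ℂ (ξ k))
    (hstat : ChordalSLE.StationaryRelations x ξ) :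
    ∃ R : RatFunc ℂ, ChordalSLE.IsCR m x R ∧ ChordalSLE.HasSimplePolesAt R ξ ∧
      ∀ (ν : ℝ → Fin n → ℝ) (T : ℝ) (xt : ℝ → Fin n → ℝ) (ξt : ℝ → Fin m → ℂ),
        ChordalSLE.IsMultipleFlow ν x ξ T xt ξt →
        ∀ t ∈ Set.Ico 0 T,
          ChordalSLE.hull ν xt t ⊆ ChordalSLE.realLocus R ∧
          Set.BijOn (ChordalSLE.flowMap ν xt t)
            (ChordalSLE.upperHalf \ ChordalSLE.hull ν xt t) ChordalSLE.upperHalf ∧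
          ∃ Rt : RatFunc ℂ, ChordalSLE.IsCR m (xt t) Rt ∧
            Set.EqOn (ChordalSLE.evalSphere R ∘ ChordalSLE.flowMapInv ν xt t)
              (ChordalSLE.evalSphere Rt) ChordalSLE.upperHalf := by
  obtain ⟨A₀, hA₀⟩ := ChordalSLE.exists_isNumerator hdistinct hconj hstat
  refine ⟨ChordalSLE.quotientOf A₀ ξ, hA₀.isCR hdistinct hconj, hA₀.hasSimplePolesAt hdistinct,
    fun ν T xt ξt h t ht => ⟨h.hull_subset hdistinct hconj hstat hA₀ ht, h.bijOn_flowMap ht, ?_⟩⟩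
  obtain ⟨A, hA, hAeq⟩ := h.exists_numerator hdistinct hconj hstat hA₀ ht
  exact ⟨ChordalSLE.quotientOf A (ξt t), hA.isCR (h.noCollision t ht) (h.conj_closed hconj ht),
    h.eqOn_evalSphere hdistinct hA₀ ht hA hAeq⟩
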